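/- Let $m$ be a natural number and $E_m=\{1,\dots,m\}$. An $m$-user binary-input multiple access channel (BMAC) $P$ consists of a measurable output space $\mathcal Y$ and, for each $x\in\mathbb F_2^m$, a probability distribution $P(\cdot\mid x)$ on $\mathcal Y$. Let $\bar X=(X[1],\dots,X[m])$ be uniformly distributed on $\mathbb F_2^m$, let $Y$ be the output of $P$ on the input $\bar X$, and for $J\subseteq E_m$ put $$I[J](P)=I\big(X[J];\,(Y,X[E_m\setminus J])\big)\quad\text{(mutual information in bits)},\qquad X[J]=(X[i])_{i\in J}.$$ Define the BMACs $P^-$, with outputs in $\mathcal Y^2$, and $P^+$, with outputs in $\mathcal Y^2\times\mathbb F_2^m$, by $$P^-(y_1,y_2\mid u_1)=\sum_{u_2\in\mathbb F_2^m}2^{-m}P(y_1\mid u_1+u_2)P(y_2\mid u_2),\qquad P^+(y_1,y_2,u_1\mid u_2)=2^{-m}P(y_1\mid u_1+u_2)P(y_2\mid u_2)$$ (for a general $\mathcal Y$, the corresponding mixtures of product measures). Let $B_1,B_2,\dots$ be i.i.d. uniform random variables with values in $\{-,+\}$, and let $P_0=P$, $P_n=P_{n-1}^{B_n}$ for $n\ge1$.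 Then, for every $m$ and every $m$-user BMAC $P$: 1. Almost surely, for every $J\subseteq E_m$ the limit $I_\infty[J]=\lim_{n\to\infty}I[J](P_n)$ exists. 2. Almost surely, $I_\infty[J]-I_\infty[J\setminus\{i\}]\in\{0,1\}$ for all $J\subseteq E_m$ and $i\in J$. 3. Almost surely, $I_\infty$ is the rank function of a matroid on $E_m$, that is, $I_\infty[\emptyset]=0$; $I_\infty[J]\le I_\infty[K]$ for $J\subseteq K$; $I_\infty[J\cup K]+I_\infty[J\cap K]\le I_\infty[J]+I_\infty[K]$ for all $J,K\subseteq E_m$; and $I_\infty$ is integer valued with $I_\infty[J]\le|J|$. 4. $I_\infty=(I_\infty[J])_{J\subseteq E_m}$ is an (almost surely defined) random vector, and the support $\mathcal A_m\subseteq\mathbb R^{2^{E_m}}$ of its distribution is contained in the set $\mathrm{MAT}_m$ of all matroid rank functions on $E_m$. -/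

import Mathlib

open MeasureTheory ProbabilityTheory Filter
open scoped ENNReal Topology

universe u v

/-- The input alphabet `F_2^m` of an `m`-user binary-input multiple access channel. The set of
users `E_m` is `Fin m`. -/
abbrev Input (m : ℕ) : Type := Fin m → ZMod 2

/-- An `m`-user multiple access channel with binary inputs and an arbitrary (measurable) output
alphabet `Out`: for every input vector `x`, `law x` is the conditional distribution `P(· | x)` of
the output. -/
structure BMAC (m : ℕ) : Type (u + 1) where
  /-- The output alphabet. -/
  Out : Type u
  [instMeas : MeasurableSpace Out]
  /-- The output distribution given the input. -/
  law : Input m → Measure Out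
  [instProb : ∀ x, IsProbabilityMeasure (law x)]

attribute [instance] BMAC.instMeas BMAC.instProb

/-- The uniform mixture of a family of measures indexed by `F_2^m`. -/
noncomputable def uniformMix {m : ℕ} {α : Type*} [MeasurableSpace α]
    (κ : Input m → Measure α) : Measure α :=
  ((2 : ℝ≥0∞) ^ m)⁻¹ • ∑ x, κ x

instance uniformMix_isProbabilityMeasure {m : ℕ} {α : Type*} [MeasurableSpace α]
    (κ : Input m → Measure α) [∀ x, IsProbabilityMeasure (κ x)] :
    IsProbabilityMeasure (uniformMix κ) := by
  constructor
  have h : (2 : ℝ≥0∞) ^ m ≠ 0 := pow_ne_zero _ two_ne_zero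
  have h' : (2 : ℝ≥0∞) ^ m ≠ ⊤ := ENNReal.pow_ne_top ENNReal.ofNat_ne_top
  simp [uniformMix, ENNReal.inv_mul_cancel h h']

/-- The mutual information `I(A; B)`, in bits, of two random variables `A`, `B` on a probability
space with measure `ρ`: the Kullback-Leibler divergence of the joint law from the product of the
marginal laws. -/
noncomputable def mutualInfo {Ω α β : Type*} [MeasurableSpace Ω] [MeasurableSpace α]
    [MeasurableSpace β] (ρ : Measure Ω) (A : Ω → α) (B : Ω → β) : ℝ :=
  (InformationTheory.klDiv (ρ.map fun ω => (A ω, B ω)) ((ρ.map A).prod (ρ.map B))).toReal /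
    Real.log 2

/-- The joint law of `(X̄, Y)`, where the inputs `X[1], …, X[m]` are independent uniform bits and
`Y` is the output of the channel with transition probabilities `W` when the input is `X̄`. -/
noncomputable def jointLaw {m : ℕ} {Y : Type*} [MeasurableSpace Y]
    (W : Input m → Measure Y) : Measure (Input m × Y) :=
  uniformMix fun x => (Measure.dirac x).prod (W x)

/-- The mutual information `I(X[J]; Y X[J^c])` when `(X̄, Y)` has the law `jointLaw W`. -/
noncomputable def channelInfo {m : ℕ} {Y : Type*} [MeasurableSpace Y]
    (W : Input m → Measure Y) (J : Finset (Fin m)) : ℝ :=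
  mutualInfo (jointLaw W)
    (fun p => fun i : {i // i ∈ J} => p.1 i)
    (fun p => (p.2, fun i : {i // i ∉ J} => p.1 i))

/-- The transition probabilities
`W⁻(y₁, y₂ | u₁) = ∑_{u₂} 2^{-m} W(y₁ | u₁ + u₂) W(y₂ | u₂)`. -/
noncomputable def minusLaw {m : ℕ} {Y : Type*} [MeasurableSpace Y]
    (W : Input m → Measure Y) (u₁ : Input m) : Measure (Y × Y) :=
  uniformMix fun u₂ => (W (u₁ + u₂)).prod (W u₂)

/-- The transition probabilities
`W⁺(y₁, y₂, u₁ | u₂) = 2^{-m} W(y₁ | u₁ + u₂) W(y₂ | u₂)`. -/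
noncomputable def plusLaw {m : ℕ} {Y : Type*} [MeasurableSpace Y]
    (W : Input m → Measure Y) (u₂ : Input m) : Measure ((Y × Y) × Input m) :=
  uniformMix fun u₁ => ((W (u₁ + u₂)).prod (W u₂)).prod (Measure.dirac u₁)

namespace BMAC

variable {m : ℕ}

/-- The mutual information `I[J](P) = I(X[J]; Y X[J^c])`. -/
noncomputable def info (P : BMAC.{u} m) (J : Finset (Fin m)) : ℝ :=
  channelInfo P.law J

/-- The channel `P⁻`. -/
noncomputable def minus (P : BMAC.{u} m) : BMAC.{u} m where
  Out := P.Out × P.Out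
  law := minusLaw P.law
  instProb _ := by unfold minusLaw; infer_instance

/-- The channel `P⁺`. -/
noncomputable def plus (P : BMAC.{u} m) : BMAC.{u} m where
  Out := (P.Out × P.Out) × Input m
  law := plusLaw P.law
  instProb _ := by unfold plusLaw; infer_instance

/-- The channels obtained from `P` along a sequence of signs (`true` is `+`, `false` is `-`):
`P_0 = P` and `P_{n+1} = P_n^{s n}`. -/
noncomputable def polarize (P : BMAC.{u} m) (s : ℕ → Bool) : ℕ → BMAC.{u} m
  | 0 => P
  | n + 1 => if s n then (P.polarize s n).plus else (P.polarize s n).minus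

/-- The function `J ↦ I_∞[J] = lim_n I[J](P_n)` along a sequence of signs (meaningful when these
limits exist). -/
noncomputable def infoLimit (P : BMAC.{u} m) (s : ℕ → Bool) : Finset (Fin m) → ℝ :=
  fun J => limUnder atTop fun n => (P.polarize s n).info J

end BMAC

/-- `B 0, B 1, …` are independent and uniformly distributed random signs. -/
structure IsIIDUniformSigns {Ω : Type*} [MeasurableSpace Ω] (μ : Measure Ω)
    (B : ℕ → Ω → Bool) : Prop where
  measurable : ∀ n, Measurable (B n)
  indep : iIndepFun B μ
  uniform : ∀ n b, μ {ω | B n ω = b} = 1 / 2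

/-- The support `A_m` of the random vector `(I_∞[J])_{J ⊆ E_m}` of the polarization process that
starts at `P` and is driven by the random signs `B`. -/
noncomputable def limitSupport {m : ℕ} {Ω : Type*} [MeasurableSpace Ω] (μ : Measure Ω)
    (B : ℕ → Ω → Bool) (P : BMAC.{u} m) : Set (Finset (Fin m) → ℝ) :=
  (μ.map fun ω => P.infoLimit fun n => B n ω).support

/-- Rank functions of polymatroids with ground set `E_m`. -/
structure IsPolymatroidRank {m : ℕ} (f : Finset (Fin m) → ℝ) : Prop where
  empty : f ∅ = 0
  mono : ∀ J K, J ⊆ K → f J ≤ f K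
  submodular : ∀ J K, f (J ∪ K) + f (J ∩ K) ≤ f J + f K

/-- Rank functions of matroids with ground set `E_m`: integer-valued polymatroid rank functions
bounded by the cardinality. -/
structure IsMatroidRank {m : ℕ} (f : Finset (Fin m) → ℝ) : Prop extends IsPolymatroidRank f where
  integer : ∀ J, ∃ k : ℤ, f J = k
  le_card : ∀ J, f J ≤ J.card

/-- The set `MAT_m` of matroids with ground set `E_m`, identified with their rank functions. -/
def MAT (m : ℕ) : Set (Finset (Fin m) → ℝ) := {f | IsMatroidRank f}

/-! Let `q x y` be the joint density of input and output relative to a finite measure `ν`, and let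
H(A) be the entropy of (Y, X[A]). Then I[J] = |J| - (H(E_m) - H(Jᶜ)) / log 2
(`channelInfo_mul_log_two`), so the claims become claims about entropies. Submodularity of entropy
makes J ↦ I[J] submodular for every channel, hence also in the limit.

Convergence: two uses of the channel, on inputs u₁ + u₂ and u₂, carry the entropies of both
transforms. Those of P⁻ ignore u₂, those of P⁺ include u₁. One instance of submodularity gives
I[J](P⁻) + I[J](P⁺) ≤ 2 I[J](P), so I[J](P_n) is a bounded supermartingale and converges almost
surely (`ae_exists_tendsto`).

Increments: e = log 2 · (1 - (I[J] - I[J \ {i}])) is the conditional entropy in nats of the bit X[i]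
given Y and X[Jᶜ], so 0 ≤ e ≤ log 2. The step + sends e to at most e - e²(log 2 - e)/16
(`bitEntropy_plusDensity_le`). This rests on a quantitative form of the fact that adding an
independent bit raises entropy (`binEntropy_add_le_binEntropy_convolution`). Its gain is a product
of one factor for each bit, so averaging over two independent channel uses gives z(1 - z)/4 exactly,
where z is the mean of 4s(1 - s). Elementary estimates bound z below and 1 - z below in terms of e.

Almost surely + occurs infinitely often, so the limit satisfies e²(log 2 - e) = 0, and the
increments of I_∞ are 0 or 1. A submodular function with these increments that vanishes at ∅ is a
matroid rank function. Such functions form a closed set, which therefore contains the support. -/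

/-! ### Entropy of unnormalised weights on a finite set -/

section FiberEntropy

open Real

variable {X X' β γ δ : Type*} [Fintype X] [Fintype X']

open Classical in
/-- The mass that the weights `q` give to the fibre of `f` over `b`. -/
noncomputable def fiberMass (q : X → ℝ) (f : X → β) (b : β) : ℝ :=
  ∑ x, if f x = b then q x else 0

/-- The (unnormalised, natural) entropy of the random variable `f` under the weights `q`. -/
noncomputable def fiberEntropy (q : X → ℝ) (f : X → β) : ℝ :=
  -∑ x, q x * log (fiberMass q f (f x))

lemma fiberMass_nonneg {q : X → ℝ} (hq : ∀ x, 0 ≤ q x) (f : X → β) (b : β) :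
    0 ≤ fiberMass q f b :=
  Finset.sum_nonneg fun x _ => by split_ifs <;> simp [hq x]

lemma le_fiberMass {q : X → ℝ} (hq : ∀ x, 0 ≤ q x) (f : X → β) (x : X) :
    q x ≤ fiberMass q f (f x) := by
  classical
  have := Finset.single_le_sum (f := fun x' => if f x' = f x then q x' else 0)
    (fun x' _ => by split_ifs <;> simp [hq x']) (Finset.mem_univ x)
  simpa [fiberMass] using this

lemma fiberMass_le_sum {q : X → ℝ} (hq : ∀ x, 0 ≤ q x) (f : X → β) (b : β) :
    fiberMass q f b ≤ ∑ x, q x :=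
  Finset.sum_le_sum fun x _ => by split_ifs <;> simp [hq x]

lemma sum_mul_fiberMass [Fintype β] (q : X → ℝ) (f : X → β) (F : β → ℝ) :
    ∑ b, F b * fiberMass q f b = ∑ x, q x * F (f x) := by
  classical
  simp only [fiberMass, Finset.mul_sum]
  rw [Finset.sum_comm]
  refine Finset.sum_congr rfl fun x _ => ?_
  simp [mul_comm]

lemma sum_fiberMass [Fintype β] (q : X → ℝ) (f : X → β) :
    ∑ b, fiberMass q f b = ∑ x, q x := by
  simpa using sum_mul_fiberMass q f fun _ => 1

lemma sum_fiberMass_prod [Fintype β] (q : X → ℝ) (f : X → β) (g : X → γ) (c : γ) :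
    ∑ b, fiberMass q (fun x => (f x, g x)) (b, c) = fiberMass q g c := by
  classical
  simp only [fiberMass]
  rw [Finset.sum_comm]
  refine Finset.sum_congr rfl fun x _ => ?_
  by_cases h : g x = c <;> simp [h]

lemma fiberMass_congr (q : X → ℝ) {f : X → β} {g : X → γ}
    (h : ∀ x x', f x = f x' ↔ g x = g x') (x : X) :
    fiberMass q f (f x) = fiberMass q g (g x) := by
  classical
  simp only [fiberMass]
  exact Finset.sum_congr rfl fun x' _ => by simp [h x' x]

lemma fiberEntropy_congr (q : X → ℝ) {f : X → β} {g : X → γ}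
    (h : ∀ x x', f x = f x' ↔ g x = g x') : fiberEntropy q f = fiberEntropy q g := by
  simp only [fiberEntropy, fiberMass_congr q h]

lemma fiberMass_comp_equiv (e : X' ≃ X) (q : X → ℝ) (f : X → β) (b : β) :
    fiberMass (fun x => q (e x)) (fun x => f (e x)) b = fiberMass q f b := by
  classical
  simp only [fiberMass]
  exact Equiv.sum_comp e fun x => if f x = b then q x else 0

lemma fiberEntropy_comp_equiv (e : X' ≃ X) (q : X → ℝ) (f : X → β) :
    fiberEntropy (fun x => q (e x)) (fun x => f (e x)) = fiberEntropy q f := by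
  simp only [fiberEntropy, fiberMass_comp_equiv]
  congr 1
  exact Equiv.sum_comp e fun x => q x * log (fiberMass q f (f x))

lemma fiberEntropy_eq_sum [Fintype β] (q : X → ℝ) (f : X → β) :
    fiberEntropy q f = ∑ b, negMulLog (fiberMass q f b) := by
  rw [fiberEntropy, ← sum_mul_fiberMass q f fun b => log (fiberMass q f b),
    ← Finset.sum_neg_distrib]
  exact Finset.sum_congr rfl fun b _ => by rw [negMulLog]; ring

/-- Refining a random variable increases its entropy. -/
lemma fiberEntropy_mono {q : X → ℝ} (hq : ∀ x, 0 ≤ q x) {f : X → β} {g : X → γ}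
    (h : ∀ x x', f x = f x' → g x = g x') : fiberEntropy q g ≤ fiberEntropy q f := by
  classical
  refine neg_le_neg (Finset.sum_le_sum fun x _ => ?_)
  rcases (hq x).eq_or_lt with h0 | h0
  · simp [← h0]
  refine mul_le_mul_of_nonneg_left (log_le_log (h0.trans_le (le_fiberMass hq f x)) ?_) h0.le
  refine Finset.sum_le_sum fun x' _ => ?_
  by_cases h1 : f x' = f x
  · simp [h1, h _ _ h1]
  · rw [if_neg h1]
    split_ifs <;> simp [hq x']

/-- Submodularity of the entropy. -/
lemma fiberEntropy_submodular [Fintype β] [Fintype γ] [Fintype δ] {q : X → ℝ}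
    (hq : ∀ x, 0 ≤ q x) (f : X → β) (g : X → γ) (k : X → δ) :
    fiberEntropy q (fun x => (f x, g x, k x)) + fiberEntropy q k ≤
      fiberEntropy q (fun x => (f x, k x)) + fiberEntropy q (fun x => (g x, k x)) := by
  set A := fiberMass q (fun x => (f x, k x)) with hA
  set B := fiberMass q (fun x => (g x, k x)) with hB
  set C := fiberMass q (fun x => (f x, g x, k x)) with hC
  set D := fiberMass q k with hD
  have hA0 := fiberMass_nonneg hq (fun x => (f x, k x))
  have hB0 := fiberMass_nonneg hq (fun x => (g x, k x))
  have hC0 := fiberMass_nonneg hq (fun x => (f x, g x, k x))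
  have hD0 := fiberMass_nonneg hq k
  -- `F` compares the law making `f` and `g` independent given `k` with the true joint law. Its mean
  -- is at most the total mass, and log t ≤ t - 1 finishes.
  let F : β × γ × δ → ℝ := fun t => A (t.1, t.2.2) * B (t.2.1, t.2.2) / (C t * D t.2.2)
  have key : ∑ x, q x * F (f x, g x, k x) ≤ ∑ x, q x := by
    rw [← sum_mul_fiberMass q (fun x => (f x, g x, k x)) F]
    calc ∑ t, F t * C t
        ≤ ∑ t : β × γ × δ, A (t.1, t.2.2) * B (t.2.1, t.2.2) / D t.2.2 := by
          refine Finset.sum_le_sum fun t _ => ?_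
          rcases (hC0 t).eq_or_lt with h0 | h0
          · rw [show C t = 0 from h0.symm, mul_zero]
            exact div_nonneg (mul_nonneg (hA0 _) (hB0 _)) (hD0 _)
          · refine le_of_eq ?_
            have h0' : C t ≠ 0 := h0.ne'
            simp only [F]
            rw [div_mul_eq_mul_div, mul_comm (C t), mul_div_mul_right _ _ h0']
      _ = ∑ d, (∑ b, A (b, d)) * (∑ c, B (c, d)) / D d := by
          simp only [Fintype.sum_prod_type, Finset.sum_mul_sum, Finset.sum_div]
          rw [Finset.sum_congr rfl fun b _ => Finset.sum_comm, Finset.sum_comm]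
      _ = ∑ d, D d := by
          refine Finset.sum_congr rfl fun d _ => ?_
          rw [hA, hB, sum_fiberMass_prod, sum_fiberMass_prod]
          -- D · D / D = D also holds where D vanishes.
          exact mul_self_div_self _
      _ = ∑ x, q x := sum_fiberMass q k
  have h1 : ∑ x, q x * (log (A (f x, k x)) + log (B (g x, k x)) - log (C (f x, g x, k x))
      - log (D (k x))) ≤ ∑ x, (q x * F (f x, g x, k x) - q x) := by
    refine Finset.sum_le_sum fun x _ => ?_
    rcases (hq x).eq_or_lt with h0 | h0
    · simp [← h0]
    have a0 : 0 < A (f x, k x) := h0.trans_le (le_fiberMass hq (fun x => (f x, k x)) x)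
    have b0 : 0 < B (g x, k x) := h0.trans_le (le_fiberMass hq (fun x => (g x, k x)) x)
    have c0 : 0 < C (f x, g x, k x) :=
      h0.trans_le (le_fiberMass hq (fun x => (f x, g x, k x)) x)
    have d0 : 0 < D (k x) := h0.trans_le (le_fiberMass hq k x)
    have := log_le_sub_one_of_pos (div_pos (mul_pos a0 b0) (mul_pos c0 d0))
    rw [log_div (by positivity) (by positivity), log_mul a0.ne' b0.ne',
      log_mul c0.ne' d0.ne'] at this
    have h2 := mul_le_mul_of_nonneg_left this h0.le
    simp only [F]
    linarith
  rw [Finset.sum_sub_distrib] at h1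
  simp only [mul_sub, mul_add, Finset.sum_sub_distrib, Finset.sum_add_distrib] at h1
  simp only [fiberEntropy]
  linarith

/-- The entropy of a pair of independent random variables. -/
lemma fiberEntropy_prodMap {q : X → ℝ} {q' : X' → ℝ} (hq : ∀ x, 0 ≤ q x) (hq' : ∀ x, 0 ≤ q' x)
    (f : X → β) (g : X' → γ) :
    fiberEntropy (fun p : X × X' => q p.1 * q' p.2) (fun p => (f p.1, g p.2)) =
      (∑ x, q' x) * fiberEntropy q f + (∑ x, q x) * fiberEntropy q' g := by
  classical
  have hm (b : β) (c : γ) : fiberMass (fun p : X × X' => q p.1 * q' p.2)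
      (fun p => (f p.1, g p.2)) (b, c) = fiberMass q f b * fiberMass q' g c := by
    simp only [fiberMass, Fintype.sum_prod_type, Finset.sum_mul_sum, Prod.mk.injEq]
    refine Finset.sum_congr rfl fun x _ => Finset.sum_congr rfl fun x' _ => ?_
    by_cases h1 : f x = b <;> by_cases h2 : g x' = c <;> simp [h1, h2]
  simp only [fiberEntropy, hm, Fintype.sum_prod_type]
  have (x : X) (x' : X') : q x * q' x' * log (fiberMass q f (f x) * fiberMass q' g (g x')) =
      q' x' * (q x * log (fiberMass q f (f x))) +
        q x * (q' x' * log (fiberMass q' g (g x'))) := by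
    rcases (hq x).eq_or_lt with h0 | h0
    · simp [← h0]
    rcases (hq' x').eq_or_lt with h0' | h0'
    · simp [← h0']
    rw [log_mul (h0.trans_le (le_fiberMass hq f x)).ne' (h0'.trans_le (le_fiberMass hq' g x')).ne']
    ring
  simp only [this, Finset.sum_add_distrib, ← Finset.sum_mul, ← Finset.mul_sum]
  ring

/-- The entropy of a function of the first component of a pair. -/
lemma fiberEntropy_comp_fst (r : X × X' → ℝ) (f : X → β) :
    fiberEntropy r (fun p => f p.1) = fiberEntropy (fun x => ∑ x', r (x, x')) f := by
  classical
  have hm (b : β) : fiberMass r (fun p => f p.1) b = fiberMass (fun x => ∑ x', r (x, x')) f b := by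
    simp only [fiberMass, Fintype.sum_prod_type]
    refine Finset.sum_congr rfl fun x _ => ?_
    split_ifs <;> simp
  simp only [fiberEntropy, hm, Fintype.sum_prod_type, Finset.sum_mul]

/-- The entropy of the first component of a pair together with a function of the second. -/
lemma fiberEntropy_fst_prod (r : X × X' → ℝ) (f : X' → β) :
    fiberEntropy r (fun p => (p.1, f p.2)) = ∑ x, fiberEntropy (fun x' => r (x, x')) f := by
  classical
  have hm (x : X) (b : β) : fiberMass r (fun p => (p.1, f p.2)) (x, b) =
      fiberMass (fun x' => r (x, x')) f b := by
    simp only [fiberMass, Fintype.sum_prod_type, Prod.mk.injEq]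
    rw [Finset.sum_eq_single x]
    · simp
    · intro y _ hy
      simp [hy]
    · simp
  simp only [fiberEntropy, hm, Fintype.sum_prod_type, Finset.sum_neg_distrib]

end FiberEntropy

/-! ### Binary entropy and the gain from adding independent bits -/

section BinaryEntropy

open Real

/-- The derivative is log((1 - s)/s) - (1 - 2s). The constant 1/4 is chosen so that log x ≥ 1 - 1/x
at x = (1 - s)/s shows this to be nonnegative. -/
lemma monotoneOn_binEntropy_add_sq :
    MonotoneOn (fun s : ℝ => binEntropy s + (1 - 2 * s) ^ 2 / 4) (Set.Icc 0 2⁻¹) := by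
  refine monotoneOn_of_deriv_nonneg (convex_Icc _ _) (by fun_prop) ?_ ?_
  · rw [interior_Icc]
    intro s hs
    have : DifferentiableAt ℝ binEntropy s :=
      differentiableAt_binEntropy hs.1.ne' (by linarith [hs.2, (by norm_num : (2⁻¹ : ℝ) < 1)] :
        s < 1).ne
    exact (this.add (by fun_prop)).differentiableWithinAt
  · rw [interior_Icc]
    intro s hs
    have hs0 := hs.1
    have hs2 : s < 2⁻¹ := hs.2
    have hs1 : s < 1 := by linarith [(by norm_num : (2⁻¹ : ℝ) < 1)]
    have h1 := hasDerivAt_binEntropy hs0.ne' hs1.ne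
    have h2 : HasDerivAt (fun s : ℝ => (1 - 2 * s) ^ 2 / 4) (-(1 - 2 * s)) s := by
      have := ((((hasDerivAt_id s).const_mul 2).const_sub 1).pow 2).div_const 4
      refine this.congr_deriv ?_
      simp
      ring
    have h3 := (h1.add h2).deriv
    have h4 : 1 - 2 * s ≤ log (1 - s) - log s := by
      have h5 := one_sub_inv_le_log_of_pos (div_pos (sub_pos.2 hs1) hs0)
      rw [log_div (sub_pos.2 hs1).ne' hs0.ne', inv_div] at h5
      refine le_trans ?_ h5
      rw [le_sub_comm, div_le_iff₀ (sub_pos.2 hs1)]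
      nlinarith
    have h6 : deriv (fun s : ℝ => binEntropy s + (1 - 2 * s) ^ 2 / 4) s =
      log (1 - s) - log s + -(1 - 2 * s) := h3
    rw [h6]
    linarith

/-- Both terms are invariant under s ↦ 1 - s, so the distance of s to 1/2 decides the comparison. -/
lemma binEntropy_add_sq_le {s t : ℝ} (hs : s ∈ Set.Icc (0 : ℝ) 1) (ht : t ∈ Set.Icc (0 : ℝ) 1)
    (h : |1 - 2 * t| ≤ |1 - 2 * s|) :
    binEntropy s + (1 - 2 * s) ^ 2 / 4 ≤ binEntropy t + (1 - 2 * t) ^ 2 / 4 := by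
  have key (s : ℝ) (hs : s ∈ Set.Icc (0 : ℝ) 1) : ∃ s' ∈ Set.Icc (0 : ℝ) 2⁻¹,
      |1 - 2 * s| = 1 - 2 * s' ∧
      binEntropy s + (1 - 2 * s) ^ 2 / 4 = binEntropy s' + (1 - 2 * s') ^ 2 / 4 := by
    rcases le_total s 2⁻¹ with h | h
    · exact ⟨s, ⟨hs.1, h⟩, abs_of_nonneg (by norm_num at h ⊢; linarith), rfl⟩
    · refine ⟨1 - s, ⟨by linarith [hs.2], by norm_num at h ⊢; linarith⟩, ?_, ?_⟩
      · rw [abs_of_nonpos (by norm_num at h ⊢; linarith)]; ring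
      · rw [binEntropy_one_sub]; ring
  obtain ⟨s', hs', e1, e2⟩ := key s hs
  obtain ⟨t', ht', e3, e4⟩ := key t ht
  rw [e2, e4]
  exact monotoneOn_binEntropy_add_sq hs' ht' (by rw [e1, e3] at h; linarith)

/-- A quantitative gain of entropy when two independent bits are added. -/
lemma binEntropy_add_le_binEntropy_convolution {s t : ℝ} (hs : s ∈ Set.Icc (0 : ℝ) 1)
    (ht : t ∈ Set.Icc (0 : ℝ) 1) :
    binEntropy s + 4⁻¹ * (4 * t * (1 - t)) * (1 - 4 * s * (1 - s)) ≤
      binEntropy (s * t + (1 - s) * (1 - t)) := by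
  obtain ⟨hs0, hs1⟩ := hs
  obtain ⟨ht0, ht1⟩ := ht
  have hu : s * t + (1 - s) * (1 - t) ∈ Set.Icc (0 : ℝ) 1 := ⟨by nlinarith, by nlinarith⟩
  have habs : |1 - 2 * (s * t + (1 - s) * (1 - t))| ≤ |1 - 2 * s| := by
    have : 1 - 2 * (s * t + (1 - s) * (1 - t)) = -((1 - 2 * s) * (1 - 2 * t)) := by ring
    rw [this, abs_neg, abs_mul]
    exact mul_le_of_le_one_right (abs_nonneg _) (abs_le.2 ⟨by linarith, by linarith⟩)
  -- With u the new parameter, 1 - 2u = -(1 - 2s)(1 - 2t), so (1 - 2s)² - (1 - 2u)² = (1 - 4s(1 -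
  -- s)) · 4t(1 - t).
  have := binEntropy_add_sq_le ⟨hs0, hs1⟩ hu habs
  nlinarith

/-- The underlying bound is 2√(s(1 - s)). The arithmetic-geometric mean inequality with a free `ε`
makes it linear in 4s(1 - s), so that it can be integrated without Jensen's inequality. -/
lemma binEntropy_le_add_div {s ε : ℝ} (hs : s ∈ Set.Icc (0 : ℝ) 1) (hε : 0 < ε) :
    binEntropy s ≤ ε + 4 * s * (1 - s) / ε := by
  have key (x : ℝ) (hx : 0 ≤ x) : negMulLog x ≤ 2 * (√x - x) := by
    rcases hx.eq_or_lt with h0 | h0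
    · simp [← h0]
    have h1 : 0 < √x := sqrt_pos.2 h0
    have h2 := one_sub_inv_le_log_of_pos h1
    have h3 : log x = 2 * log √x := by rw [log_sqrt hx]; ring
    have h4 : √x * √x = x := mul_self_sqrt hx
    have h5 : x * (√x)⁻¹ = √x := by rw [← div_eq_mul_inv, div_sqrt]
    have h6 := mul_le_mul_of_nonneg_left h2 hx
    rw [negMulLog, h3]
    nlinarith
  obtain ⟨hs0, hs1⟩ := hs
  rw [binEntropy_eq_negMulLog_add_negMulLog_one_sub]
  have h1 := key s hs0
  have h2 := key (1 - s) (by linarith)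
  have ha := sqrt_nonneg s
  have hb := sqrt_nonneg (1 - s)
  have ha2 : √s ^ 2 = s := sq_sqrt hs0
  have hb2 : √(1 - s) ^ 2 = 1 - s := sq_sqrt (by linarith)
  set a := √s
  set b := √(1 - s)
  -- This is (1 - a)(1 - b) ≥ 0 for a² + b² = 1.
  have h3 : a + b ≤ 1 + a * b := by
    have := mul_nonneg ha hb
    nlinarith [sq_nonneg (a * b), sq_nonneg (a + b - 1)]
  have h4 : 2 * (a * b) ≤ ε + 4 * s * (1 - s) / ε := by
    rw [← sub_le_iff_le_add', le_div_iff₀ hε]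
    have : (a * b) ^ 2 = s * (1 - s) := by rw [mul_pow, ha2, hb2]
    nlinarith [sq_nonneg (a * b - ε), sq_nonneg (a * b)]
  linarith

/-- Apply log(2x) ≤ 2x - 1 at x = s and at x = 1 - s, and average with weights s and 1 - s. -/
lemma log_two_sub_le_binEntropy {s : ℝ} (hs : s ∈ Set.Icc (0 : ℝ) 1) :
    log 2 - (1 - 4 * s * (1 - s)) ≤ binEntropy s := by
  have key (x : ℝ) (hx : 0 ≤ x) : x * (log 2 - (2 * x - 1)) ≤ negMulLog x := by
    rcases hx.eq_or_lt with h0 | h0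
    · simp [← h0]
    have h1 := log_le_sub_one_of_pos (mul_pos two_pos h0)
    rw [log_mul two_ne_zero h0.ne'] at h1
    rw [negMulLog]
    nlinarith
  rw [binEntropy_eq_negMulLog_add_negMulLog_one_sub]
  have h1 := key s hs.1
  have h2 := key (1 - s) (by linarith [hs.2])
  nlinarith

/-- The entropy of an unnormalised distribution on two points, weighted by its mass. -/
noncomputable def pairEntropy (a b : ℝ) : ℝ := negMulLog a + negMulLog b - negMulLog (a + b)

/-- The weighted squared Bhattacharyya coefficient of an unnormalised distribution on two
points. -/
noncomputable def pairBhattacharyya (a b : ℝ) : ℝ := 4 * a * b / (a + b)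

/-- The pair quantities are homogeneous, so this reduces their inequalities to those for a single
parameter s. At mass 0 the choice of s is immaterial. -/
lemma exists_eq_mass_mul {a b : ℝ} (ha : 0 ≤ a) (hb : 0 ≤ b) :
    ∃ M s : ℝ, 0 ≤ M ∧ s ∈ Set.Icc (0 : ℝ) 1 ∧ a = M * s ∧ b = M * (1 - s) := by
  rcases (add_nonneg ha hb).eq_or_lt with h | h
  · exact ⟨0, 0, le_rfl, by simp, by linarith, by linarith⟩
  · refine ⟨a + b, a / (a + b), h.le, ⟨by positivity, ?_⟩, ?_, ?_⟩
    · rw [div_le_one h]; linarith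
    · field_simp
    · field_simp; ring

lemma pairEntropy_mass_mul (M s : ℝ) :
    pairEntropy (M * s) (M * (1 - s)) = M * binEntropy s := by
  rw [pairEntropy, ← mul_add, add_sub_cancel, mul_one, negMulLog_mul, negMulLog_mul,
    binEntropy_eq_negMulLog_add_negMulLog_one_sub]
  ring

lemma pairBhattacharyya_mass_mul (M s : ℝ) :
    pairBhattacharyya (M * s) (M * (1 - s)) = M * (4 * s * (1 - s)) := by
  rw [pairBhattacharyya, ← mul_add, add_sub_cancel, mul_one]
  rcases eq_or_ne M 0 with rfl | h
  · simp
  · field_simp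

variable {a b c d : ℝ}

lemma pairEntropy_le_log_two_mul (ha : 0 ≤ a) (hb : 0 ≤ b) :
    pairEntropy a b ≤ log 2 * (a + b) := by
  obtain ⟨M, s, hM, hs, rfl, rfl⟩ := exists_eq_mass_mul ha hb
  rw [pairEntropy_mass_mul]
  nlinarith [mul_le_mul_of_nonneg_left (binEntropy_le_log_two (p := s)) hM]

lemma pairEntropy_le_add_div {ε : ℝ} (hε : 0 < ε) (ha : 0 ≤ a) (hb : 0 ≤ b) :
    pairEntropy a b ≤ ε * (a + b) + pairBhattacharyya a b / ε := by
  obtain ⟨M, s, hM, hs, rfl, rfl⟩ := exists_eq_mass_mul ha hb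
  rw [pairEntropy_mass_mul, pairBhattacharyya_mass_mul]
  calc M * binEntropy s ≤ M * (ε + 4 * s * (1 - s) / ε) :=
        mul_le_mul_of_nonneg_left (binEntropy_le_add_div hs hε) hM
    _ = _ := by ring

lemma log_two_mul_sub_le_pairEntropy (ha : 0 ≤ a) (hb : 0 ≤ b) :
    log 2 * (a + b) - (a + b - pairBhattacharyya a b) ≤ pairEntropy a b := by
  obtain ⟨M, s, hM, hs, rfl, rfl⟩ := exists_eq_mass_mul ha hb
  rw [pairEntropy_mass_mul, pairBhattacharyya_mass_mul]
  calc _ = M * (log 2 - (1 - 4 * s * (1 - s))) := by ring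
    _ ≤ _ := mul_le_mul_of_nonneg_left (log_two_sub_le_binEntropy hs) hM

lemma pairBhattacharyya_nonneg (ha : 0 ≤ a) (hb : 0 ≤ b) : 0 ≤ pairBhattacharyya a b := by
  unfold pairBhattacharyya; positivity

lemma pairBhattacharyya_le (ha : 0 ≤ a) (hb : 0 ≤ b) : pairBhattacharyya a b ≤ a + b := by
  refine div_le_of_le_mul₀ (by positivity) (by positivity) ?_
  nlinarith [sq_nonneg (a - b)]

lemma add_le_pairEntropy_convolution (ha : 0 ≤ a) (hb : 0 ≤ b) (hc : 0 ≤ c) (hd : 0 ≤ d) :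
    (c + d) * pairEntropy a b +
        4⁻¹ * (pairBhattacharyya c d * (a + b - pairBhattacharyya a b)) ≤
      pairEntropy (a * c + b * d) (a * d + b * c) := by
  obtain ⟨M, s, hM, hs, rfl, rfl⟩ := exists_eq_mass_mul ha hb
  obtain ⟨N, t, hN, ht, rfl, rfl⟩ := exists_eq_mass_mul hc hd
  have e1 : M * s * (N * t) + M * (1 - s) * (N * (1 - t)) =
    (M * N) * (s * t + (1 - s) * (1 - t)) := by ring
  have e2 : M * s * (N * (1 - t)) + M * (1 - s) * (N * t) =
    (M * N) * (1 - (s * t + (1 - s) * (1 - t))) := by ring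
  rw [e1, e2]
  simp only [pairEntropy_mass_mul, pairBhattacharyya_mass_mul]
  calc _ = (M * N) * (binEntropy s + 4⁻¹ * (4 * t * (1 - t)) * (1 - 4 * s * (1 - s))) := by ring
    _ ≤ _ := mul_le_mul_of_nonneg_left (binEntropy_add_le_binEntropy_convolution hs ht)
      (mul_nonneg hM hN)

variable {X X' β γ : Type*} [Fintype X] [Fintype X']

/-- The chain rule: each value of `f` contributes the binary entropy of `g` on its fibre, weighted
by the mass of the fibre. -/
lemma fiberEntropy_prod_bit [Fintype β] (q : X → ℝ) (f : X → β) (g : X → ZMod 2) :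
    fiberEntropy q (fun x => (f x, g x)) = fiberEntropy q f +
      ∑ b, pairEntropy (fiberMass q (fun x => (f x, g x)) (b, 0))
        (fiberMass q (fun x => (f x, g x)) (b, 1)) := by
  have h (b : β) : fiberMass q f b = fiberMass q (fun x => (f x, g x)) (b, 0) +
      fiberMass q (fun x => (f x, g x)) (b, 1) := by
    classical
    simp only [fiberMass, ← Finset.sum_add_distrib]
    refine Finset.sum_congr rfl fun x _ => ?_
    have : g x = 0 ∨ g x = 1 := by generalize g x = z; revert z; decide
    rcases this with h | h <;> by_cases h' : f x = b <;> simp [h, h']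
  rw [fiberEntropy_eq_sum, fiberEntropy_eq_sum q f, ← Finset.sum_add_distrib,
    Fintype.sum_prod_type]
  refine Finset.sum_congr rfl fun b _ => ?_
  rw [pairEntropy, ← h]
  rw [show (Finset.univ : Finset (ZMod 2)) = {0, 1} from rfl, Finset.sum_pair (by decide)]
  ring

/-- On the fibre over (b, c) the law of the sum is the convolution of two laws on F₂, which is the
form needed by `add_le_pairEntropy_convolution`. -/
lemma fiberMass_prod_add_bit (q : X → ℝ) (q' : X' → ℝ) (f : X → β) (f' : X' → γ)
    (g : X → ZMod 2) (g' : X' → ZMod 2) (b : β) (c : γ) (z : ZMod 2) :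
    fiberMass (fun p : X × X' => q p.1 * q' p.2)
        (fun p => ((f p.1, f' p.2), g p.1 + g' p.2)) ((b, c), z) =
      fiberMass q (fun x => (f x, g x)) (b, 0) * fiberMass q' (fun x => (f' x, g' x)) (c, z) +
      fiberMass q (fun x => (f x, g x)) (b, 1) *
        fiberMass q' (fun x => (f' x, g' x)) (c, z + 1) := by
  classical
  simp only [fiberMass, Fintype.sum_prod_type, Finset.sum_mul_sum, ← Finset.sum_add_distrib]
  refine Finset.sum_congr rfl fun x _ => Finset.sum_congr rfl fun x' _ => ?_
  have key : ∀ u v z : ZMod 2, (u = 0 ∧ (u + v = z ↔ v = z)) ∨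
      (u = 1 ∧ (u + v = z ↔ v = z + 1)) := by decide
  by_cases h1 : f x = b <;> by_cases h2 : f' x' = c <;> simp [h1, h2]
  rcases key (g x) (g' x') z with ⟨h, h'⟩ | ⟨h, h'⟩
  · simp [h]
  · rw [h] at h' ⊢
    simp [h']

variable [Fintype β] [Fintype γ]

/-- The total weighted squared Bhattacharyya coefficient of the bit `g` given `f`. -/
noncomputable def fiberBhattacharyya (q : X → ℝ) (f : X → β) (g : X → ZMod 2) : ℝ :=
  ∑ b, pairBhattacharyya (fiberMass q (fun x => (f x, g x)) (b, 0))
    (fiberMass q (fun x => (f x, g x)) (b, 1))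

variable {q : X → ℝ} {q' : X' → ℝ}

lemma sum_fiberMass_prod_bit (q : X → ℝ) (f : X → β) (g : X → ZMod 2) :
    ∑ b, (fiberMass q (fun x => (f x, g x)) (b, 0) + fiberMass q (fun x => (f x, g x)) (b, 1)) =
      ∑ x, q x := by
  rw [← sum_fiberMass q (fun x => (f x, g x)), Fintype.sum_prod_type]
  refine Finset.sum_congr rfl fun b _ => ?_
  rw [show (Finset.univ : Finset (ZMod 2)) = {0, 1} from rfl, Finset.sum_pair (by decide)]

lemma fiberBhattacharyya_nonneg (hq : ∀ x, 0 ≤ q x) (f : X → β) (g : X → ZMod 2) :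
    0 ≤ fiberBhattacharyya q f g :=
  Finset.sum_nonneg fun _ _ =>
    pairBhattacharyya_nonneg (fiberMass_nonneg hq _ _) (fiberMass_nonneg hq _ _)

lemma fiberBhattacharyya_le (hq : ∀ x, 0 ≤ q x) (f : X → β) (g : X → ZMod 2) :
    fiberBhattacharyya q f g ≤ ∑ x, q x := by
  rw [← sum_fiberMass_prod_bit q f g]
  exact Finset.sum_le_sum fun _ _ =>
    pairBhattacharyya_le (fiberMass_nonneg hq _ _) (fiberMass_nonneg hq _ _)

lemma fiberEntropy_prod_bit_le_log_two (hq : ∀ x, 0 ≤ q x) (f : X → β) (g : X → ZMod 2) :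
    fiberEntropy q (fun x => (f x, g x)) - fiberEntropy q f ≤ log 2 * ∑ x, q x := by
  rw [fiberEntropy_prod_bit, add_sub_cancel_left, ← sum_fiberMass_prod_bit q f g, Finset.mul_sum]
  exact Finset.sum_le_sum fun _ _ =>
    pairEntropy_le_log_two_mul (fiberMass_nonneg hq _ _) (fiberMass_nonneg hq _ _)

lemma fiberEntropy_prod_bit_le_add_div {ε : ℝ} (hε : 0 < ε) (hq : ∀ x, 0 ≤ q x) (f : X → β)
    (g : X → ZMod 2) :
    fiberEntropy q (fun x => (f x, g x)) - fiberEntropy q f ≤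
      ε * ∑ x, q x + fiberBhattacharyya q f g / ε := by
  rw [fiberEntropy_prod_bit, add_sub_cancel_left, ← sum_fiberMass_prod_bit q f g, Finset.mul_sum,
    fiberBhattacharyya, Finset.sum_div, ← Finset.sum_add_distrib]
  exact Finset.sum_le_sum fun _ _ =>
    pairEntropy_le_add_div hε (fiberMass_nonneg hq _ _) (fiberMass_nonneg hq _ _)

lemma log_two_mul_sub_le_fiberEntropy_prod_bit (hq : ∀ x, 0 ≤ q x) (f : X → β)
    (g : X → ZMod 2) :
    log 2 * ∑ x, q x - (∑ x, q x - fiberBhattacharyya q f g) ≤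
      fiberEntropy q (fun x => (f x, g x)) - fiberEntropy q f := by
  rw [fiberEntropy_prod_bit, add_sub_cancel_left, ← sum_fiberMass_prod_bit q f g, Finset.mul_sum,
    fiberBhattacharyya, ← Finset.sum_sub_distrib, ← Finset.sum_sub_distrib]
  exact Finset.sum_le_sum fun _ _ =>
    log_two_mul_sub_le_pairEntropy (fiberMass_nonneg hq _ _) (fiberMass_nonneg hq _ _)

/-- A quantitative gain of conditional entropy when two independent bits are added. -/
lemma add_le_fiberEntropy_prod_add_bit (hq : ∀ x, 0 ≤ q x) (hq' : ∀ x, 0 ≤ q' x)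
    (f : X → β) (f' : X' → γ) (g : X → ZMod 2) (g' : X' → ZMod 2) :
    (∑ x, q' x) * (fiberEntropy q (fun x => (f x, g x)) - fiberEntropy q f) +
        4⁻¹ * (fiberBhattacharyya q' f' g' * (∑ x, q x - fiberBhattacharyya q f g)) ≤
      fiberEntropy (fun p : X × X' => q p.1 * q' p.2)
          (fun p => ((f p.1, f' p.2), g p.1 + g' p.2)) -
        fiberEntropy (fun p : X × X' => q p.1 * q' p.2) (fun p => (f p.1, f' p.2)) := by
  rw [fiberEntropy_prod_bit, fiberEntropy_prod_bit (fun p : X × X' => q p.1 * q' p.2),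
    add_sub_cancel_left, add_sub_cancel_left]
  simp only [Fintype.sum_prod_type, fiberMass_prod_add_bit, zero_add, show (1 : ZMod 2) + 1 = 0 from rfl]
  rw [← sum_fiberMass_prod_bit q f g, ← sum_fiberMass_prod_bit q' f' g', fiberBhattacharyya,
    fiberBhattacharyya, ← Finset.sum_sub_distrib, mul_comm (∑ _, _), Finset.sum_mul_sum,
    mul_comm (∑ _, _) (∑ _, _ : ℝ), Finset.sum_mul_sum, Finset.mul_sum,
    ← Finset.sum_add_distrib]
  refine Finset.sum_le_sum fun b _ => ?_
  rw [Finset.mul_sum, ← Finset.sum_add_distrib]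
  refine Finset.sum_le_sum fun c _ => ?_
  have := add_le_pairEntropy_convolution (fiberMass_nonneg hq (fun x => (f x, g x)) (b, 0))
    (fiberMass_nonneg hq (fun x => (f x, g x)) (b, 1))
    (fiberMass_nonneg hq' (fun x => (f' x, g' x)) (c, 0))
    (fiberMass_nonneg hq' (fun x => (f' x, g' x)) (c, 1))
  refine le_trans (le_of_eq ?_) this
  ring

end BinaryEntropy

/-! ### Divergence computed from a density with finite side information -/

section FiniteSideInformation

variable {α β Y : Type*} [Fintype α] [Fintype β] [MeasurableSpace α] [MeasurableSpace β]
  [MeasurableSingletonClass α] [MeasurableSingletonClass β] [MeasurableSpace Y]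

lemma lintegral_count_prod_prod_count (ν : Measure Y) [SFinite ν] {F : α × (Y × β) → ℝ≥0∞}
    (hF : Measurable F) :
    ∫⁻ z, F z ∂((Measure.count : Measure α).prod (ν.prod (Measure.count : Measure β))) =
      ∑ a, ∑ b, ∫⁻ y, F (a, (y, b)) ∂ν := by
  rw [lintegral_prod _ hF.aemeasurable, lintegral_count, tsum_fintype]
  refine Finset.sum_congr rfl fun a _ => ?_
  have hFa : Measurable fun w : Y × β => F (a, w) := hF.comp measurable_prodMk_left
  rw [lintegral_prod _ hFa.aemeasurable]
  simp only [lintegral_count, tsum_fintype]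
  exact lintegral_finsetSum _ fun b _ => hFa.comp measurable_prodMk_right

variable (ν : Measure Y) [IsFiniteMeasure ν] (r : α → β → Y → ℝ)

/-- The measure on `α × (Y × β)` with density `r` with respect to `ν` and counting measures. -/
noncomputable def densityMeasure : Measure (α × (Y × β)) :=
  ((Measure.count : Measure α).prod (ν.prod (Measure.count : Measure β))).withDensity
    fun z => ENNReal.ofReal (r z.1 z.2.2 z.2.1)

variable {r}

lemma measurable_uncurry_density (hr : ∀ a b, Measurable (r a b)) :
    Measurable fun z : α × (Y × β) => r z.1 z.2.2 z.2.1 := by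
  have : Measurable fun w : (α × β) × Y => r w.1.1 w.1.2 w.2 :=
    measurable_from_prod_countable_right fun p => hr p.1 p.2
  exact this.comp ((measurable_fst.prodMk (measurable_snd.comp measurable_snd)).prodMk
    (measurable_fst.comp measurable_snd))

lemma lintegral_densityMeasure (hr : ∀ a b, Measurable (r a b)) {F : α × (Y × β) → ℝ≥0∞}
    (hF : Measurable F) :
    ∫⁻ z, F z ∂(densityMeasure ν r) =
      ∑ a, ∑ b, ∫⁻ y, ENNReal.ofReal (r a b y) * F (a, (y, b)) ∂ν := by
  have hm := (measurable_uncurry_density hr).ennreal_ofReal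
  rw [densityMeasure, lintegral_withDensity_eq_lintegral_mul _ hm hF,
    lintegral_count_prod_prod_count ν (hm.mul hF)]
  rfl

lemma map_fst_densityMeasure (hr : ∀ a b, Measurable (r a b)) {c : ℝ≥0∞}
    (hc : ∀ a, ∑ b, ∫⁻ y, ENNReal.ofReal (r a b y) ∂ν = c) :
    (densityMeasure ν r).map Prod.fst = c • (Measure.count : Measure α) := by
  refine Measure.ext_of_lintegral _ fun f hf => ?_
  rw [lintegral_map hf measurable_fst, lintegral_densityMeasure ν hr (F := fun z => f z.1) (hf.comp measurable_fst),
    lintegral_smul_measure, lintegral_count, tsum_fintype, smul_eq_mul, Finset.mul_sum]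
  refine Finset.sum_congr rfl fun a _ => ?_
  rw [← hc a, Finset.sum_mul]
  refine Finset.sum_congr rfl fun b _ => ?_
  exact lintegral_mul_const (f a) (hr a b).ennreal_ofReal

lemma map_snd_densityMeasure (hr : ∀ a b, Measurable (r a b)) (hr0 : ∀ a b y, 0 ≤ r a b y) :
    (densityMeasure ν r).map Prod.snd =
      (ν.prod (Measure.count : Measure β)).withDensity
        fun w => ENNReal.ofReal (∑ a, r a w.2 w.1) := by
  have hm : Measurable fun w : Y × β => ENNReal.ofReal (∑ a, r a w.2 w.1) :=
    (Finset.measurable_sum _ fun a _ =>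
      (measurable_uncurry_density hr).comp measurable_prodMk_left).ennreal_ofReal
  refine Measure.ext_of_lintegral _ fun f hf => ?_
  rw [lintegral_map hf measurable_snd, lintegral_densityMeasure ν hr (F := fun z => f z.2) (hf.comp measurable_snd),
    lintegral_withDensity_eq_lintegral_mul _ hm hf, lintegral_prod _ (hm.mul hf).aemeasurable,
    Finset.sum_comm]
  simp only [lintegral_count, tsum_fintype, Pi.mul_apply]
  have hb (b : β) : Measurable fun y => ENNReal.ofReal (∑ a, r a b y) * f (y, b) :=
    (hm.mul hf).comp measurable_prodMk_right
  rw [lintegral_finsetSum _ fun b _ => hb b]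
  refine Finset.sum_congr rfl fun b _ => ?_
  have ha (a : α) : Measurable fun y => ENNReal.ofReal (r a b y) * f (y, b) :=
    (hr a b).ennreal_ofReal.mul (hf.comp measurable_prodMk_right)
  rw [← lintegral_finsetSum _ fun a _ => ha a]
  refine lintegral_congr fun y => ?_
  rw [ENNReal.ofReal_sum_of_nonneg fun a _ => hr0 a b y, Finset.sum_mul]

/-- The divergence of `densityMeasure ν r` from the product of its marginals, when the first one
is uniform. -/
lemma toReal_klDiv_densityMeasure [Nonempty α] (hr : ∀ a b, Measurable (r a b))
    (hr0 : ∀ a b y, 0 ≤ r a b y)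
    (hc : ∀ a, ∑ b, ∫⁻ y, ENNReal.ofReal (r a b y) ∂ν = (Fintype.card α : ℝ≥0∞)⁻¹) :
    (InformationTheory.klDiv (densityMeasure ν r) (((densityMeasure ν r).map Prod.fst).prod
        ((densityMeasure ν r).map Prod.snd))).toReal =
      ∫ z, Real.log (Fintype.card α * r z.1 z.2.2 z.2.1 / ∑ a, r a z.2.2 z.2.1)
        ∂(densityMeasure ν r) := by
  set π := densityMeasure ν r with hπ
  have hcard : (Fintype.card α : ℝ≥0∞) ≠ 0 := by simp
  have hcard' : (Fintype.card α : ℝ≥0∞) ≠ ∞ := by simp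
  have : IsProbabilityMeasure π := by
    constructor
    rw [← lintegral_one, hπ, lintegral_densityMeasure ν hr measurable_const]
    simp only [mul_one, hc]
    simp [ENNReal.mul_inv_cancel hcard hcard']
  have h1 : IsProbabilityMeasure (π.map Prod.fst) :=
    Measure.isProbabilityMeasure_map measurable_fst.aemeasurable
  have h2 : IsProbabilityMeasure (π.map Prod.snd) :=
    Measure.isProbabilityMeasure_map measurable_snd.aemeasurable
  set ρ := (π.map Prod.fst).prod (π.map Prod.snd) with hρ
  have hrm := measurable_uncurry_density hr
  have hsm : Measurable fun z : α × (Y × β) => ∑ a, r a z.2.2 z.2.1 :=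
    Finset.measurable_sum _ fun a _ => hrm.comp (measurable_prodMk_left.comp measurable_snd)
  set h : α × (Y × β) → ℝ := fun z =>
    Fintype.card α * r z.1 z.2.2 z.2.1 / ∑ a, r a z.2.2 z.2.1 with hh
  have hhm : Measurable h := (hrm.const_mul _).div hsm
  have hh0 : ∀ z, 0 ≤ h z := fun z =>
    div_nonneg (mul_nonneg (Nat.cast_nonneg _) (hr0 _ _ _)) (Finset.sum_nonneg fun _ _ => hr0 _ _ _)
  -- `h` is the likelihood ratio of the joint law to the product of its marginals. Where the
  -- marginal density vanishes so does every `r a`, so the value 0/0 = 0 does no harm.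
  have hdens : π = ρ.withDensity fun z => ENNReal.ofReal (h z) := by
    have hgm : Measurable fun w : Y × β => ENNReal.ofReal (∑ a, r a w.2 w.1) :=
      (Finset.measurable_sum _ fun a _ => hrm.comp measurable_prodMk_left).ennreal_ofReal
    have hρ' : ρ = (Fintype.card α : ℝ≥0∞)⁻¹ •
        ((Measure.count : Measure α).prod (ν.prod (Measure.count : Measure β))).withDensity
          fun z => ENNReal.ofReal (∑ a, r a z.2.2 z.2.1) := by
      rw [hρ, hπ, map_fst_densityMeasure ν hr hc, map_snd_densityMeasure ν hr hr0,
        Measure.prod_smul_left, prod_withDensity_right hgm]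
    rw [hρ', withDensity_smul_measure, ← withDensity_mul _ hsm.ennreal_ofReal hhm.ennreal_ofReal,
      ← withDensity_smul _ (hsm.ennreal_ofReal.mul hhm.ennreal_ofReal), hπ, densityMeasure]
    congr 1
    funext z
    simp only [Pi.smul_apply, Pi.mul_apply, smul_eq_mul]
    have hs0 : 0 ≤ ∑ a, r a z.2.2 z.2.1 := Finset.sum_nonneg fun _ _ => hr0 _ _ _
    rw [← ENNReal.ofReal_mul hs0]
    rcases hs0.eq_or_lt with h0 | h0
    · have := (Finset.sum_eq_zero_iff_of_nonneg fun a _ => hr0 a _ _).1 h0.symm z.1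
        (Finset.mem_univ _)
      simp [this, hh]
    · rw [hh, mul_div_cancel₀ _ h0.ne', ENNReal.ofReal_mul (Nat.cast_nonneg _),
        ENNReal.ofReal_natCast, ← mul_assoc, ENNReal.inv_mul_cancel hcard hcard', one_mul]
  have hac : π ≪ ρ := by
    rw [hdens]; exact withDensity_absolutelyContinuous _ _
  rw [InformationTheory.toReal_klDiv_of_measure_eq hac (by simp)]
  refine integral_congr_ae ?_
  have h3 : π.rnDeriv ρ =ᵐ[ρ] fun z => ENNReal.ofReal (h z) := by
    nth_rw 1 [hdens]
    exact Measure.rnDeriv_withDensity ρ hhm.ennreal_ofReal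
  filter_upwards [hac.ae_le h3] with z hz
  rw [llr, hz, ENNReal.toReal_ofReal (hh0 z)]

end FiniteSideInformation

/-! ### Channel densities and mutual information as a difference of entropies -/

section ChannelDensity

variable {X Y β : Type*} [Fintype X] [MeasurableSpace Y]

/-- A measurable family of subprobability weights on a finite set. -/
structure IsSubprobWeight (q : X → Y → ℝ) : Prop where
  measurable : ∀ x, Measurable (q x)
  nonneg : ∀ x y, 0 ≤ q x y
  sum_le : ∀ y, ∑ x, q x y ≤ 1

namespace IsSubprobWeight

variable {q : X → Y → ℝ}

lemma le_one (hq : IsSubprobWeight q) (x : X) (y : Y) : q x y ≤ 1 :=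
  (Finset.single_le_sum (f := fun x => q x y) (fun x _ => hq.nonneg x y)
    (Finset.mem_univ x)).trans (hq.sum_le y)

lemma measurable_fiberMass (hq : IsSubprobWeight q) (f : X → β) (b : β) :
    Measurable fun y => fiberMass (fun x => q x y) f b := by
  refine Finset.measurable_sum _ fun x _ => ?_
  split_ifs
  · exact hq.measurable x
  · exact measurable_const

/-- Since q ≤ M ≤ 1, one has 0 ≤ -q log M ≤ -M log M ≤ 1 - M. The pointwise mass bound in
`IsSubprobWeight` thus makes all entropy integrands bounded, hence integrable for finite `ν`. -/
lemma abs_mul_log_le (hq : IsSubprobWeight q) (f : X → β) (x : X) (y : Y) :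
    |q x y * Real.log (fiberMass (fun x => q x y) f (f x))| ≤ 1 := by
  set M := fiberMass (fun x => q x y) f (f x)
  have hM : q x y ≤ M := le_fiberMass (fun x => hq.nonneg x y) f x
  have hM0 : 0 ≤ M := (hq.nonneg x y).trans hM
  have hM1 : M ≤ 1 := (fiberMass_le_sum (fun x => hq.nonneg x y) f _).trans (hq.sum_le y)
  have hl : Real.log M ≤ 0 := Real.log_nonpos hM0 hM1
  rw [abs_of_nonpos (mul_nonpos_of_nonneg_of_nonpos (hq.nonneg x y) hl)]
  have h1 := Real.negMulLog_le_one_sub_self hM0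
  rw [Real.negMulLog] at h1
  nlinarith

lemma integrable (hq : IsSubprobWeight q) (ν : Measure Y) [IsFiniteMeasure ν]
    (x : X) : Integrable (q x) ν :=
  Integrable.of_bound (hq.measurable x).aestronglyMeasurable 1
    (Eventually.of_forall fun y => by
      rw [Real.norm_of_nonneg (hq.nonneg x y)]; exact hq.le_one x y)

lemma integrable_mul_log (hq : IsSubprobWeight q) (ν : Measure Y) [IsFiniteMeasure ν]
    (f : X → β) (x : X) :
    Integrable (fun y => q x y * Real.log (fiberMass (fun x => q x y) f (f x))) ν :=
  Integrable.of_bound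
    ((hq.measurable x).mul (Real.measurable_log.comp
      (hq.measurable_fiberMass f (f x)))).aestronglyMeasurable 1
    (Eventually.of_forall fun y => hq.abs_mul_log_le f x y)

lemma integrable_fiberEntropy (hq : IsSubprobWeight q) (ν : Measure Y) [IsFiniteMeasure ν]
    (f : X → β) :
    Integrable (fun y => fiberEntropy (fun x => q x y) f) ν :=
  (integrable_finsetSum _ fun x _ => hq.integrable_mul_log ν f x).neg

lemma integrable_sum (hq : IsSubprobWeight q) (ν : Measure Y) [IsFiniteMeasure ν]
    : Integrable (fun y => ∑ x, q x y) ν :=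
  integrable_finsetSum _ fun x _ => hq.integrable ν x

end IsSubprobWeight

/-- The joint entropy of a function of the input and the output, relative to `ν`. -/
noncomputable def outputEntropy (ν : Measure Y) (q : X → Y → ℝ) (f : X → β) : ℝ :=
  ∫ y, fiberEntropy (fun x => q x y) f ∂ν

/-- The restriction of an input vector to the users in `A`. -/
def restrictInput {m : ℕ} (A : Finset (Fin m)) (x : Input m) : {i // i ∈ A} → ZMod 2 :=
  fun i => x i

lemma restrictInput_eq_iff {m : ℕ} (A : Finset (Fin m)) (x x' : Input m) :
    restrictInput A x = restrictInput A x' ↔ ∀ i ∈ A, x i = x' i := by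
  simp [restrictInput, funext_iff]

variable {m : ℕ}

/-- `q x` is, up to the factor `2 ^ m`, a density of the channel law `W x` with respect to `ν`. -/
structure HasChannelDensity (W : Input m → Measure Y) (ν : Measure Y)
    (q : Input m → Y → ℝ) : Prop extends IsSubprobWeight q where
  law_eq : ∀ x, W x = (2 : ℝ≥0∞) ^ m • ν.withDensity fun y => ENNReal.ofReal (q x y)

namespace HasChannelDensity

variable {W : Input m → Measure Y} {ν : Measure Y} {q : Input m → Y → ℝ}

lemma two_pow_ne_zero : (2 : ℝ≥0∞) ^ m ≠ 0 := pow_ne_zero _ two_ne_zero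

lemma two_pow_ne_top : (2 : ℝ≥0∞) ^ m ≠ ∞ := ENNReal.pow_ne_top ENNReal.ofNat_ne_top

lemma inv_smul_law (h : HasChannelDensity W ν q) (x : Input m) :
    ((2 : ℝ≥0∞) ^ m)⁻¹ • W x = ν.withDensity fun y => ENNReal.ofReal (q x y) := by
  rw [h.law_eq, smul_smul, ENNReal.inv_mul_cancel two_pow_ne_zero two_pow_ne_top, one_smul]

lemma lintegral_eq (h : HasChannelDensity W ν q) [∀ x, IsProbabilityMeasure (W x)]
    (x : Input m) : ∫⁻ y, ENNReal.ofReal (q x y) ∂ν = ((2 : ℝ≥0∞) ^ m)⁻¹ := by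
  have := congrArg (fun μ : Measure Y => μ Set.univ) (h.inv_smul_law x)
  simpa using this.symm

lemma integral_sum_eq_one [IsFiniteMeasure ν] (h : HasChannelDensity W ν q)
    [∀ x, IsProbabilityMeasure (W x)] : ∫ y, ∑ x, q x y ∂ν = 1 := by
  rw [integral_finsetSum _ fun x _ => h.integrable ν x]
  have (x : Input m) : ∫ y, q x y ∂ν = ((2 : ℝ) ^ m)⁻¹ := by
    rw [integral_eq_lintegral_of_nonneg_ae (Eventually.of_forall (h.nonneg x))
      (h.measurable x).aestronglyMeasurable, h.lintegral_eq]
    simp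
  simp [this]

lemma lintegral_jointLaw (h : HasChannelDensity W ν q) [IsFiniteMeasure ν]
    {F : Input m × Y → ℝ≥0∞} (hF : Measurable F) :
    ∫⁻ p, F p ∂(jointLaw W) = ∑ x, ∫⁻ y, ENNReal.ofReal (q x y) * F (x, y) ∂ν := by
  have hW (x : Input m) : SFinite (W x) := by rw [h.law_eq]; infer_instance
  rw [jointLaw, uniformMix, lintegral_smul_measure, lintegral_finsetSum_measure,
    smul_eq_mul, Finset.mul_sum]
  refine Finset.sum_congr rfl fun x _ => ?_
  have hFx : Measurable fun y => F (x, y) := hF.comp measurable_prodMk_left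
  rw [Measure.dirac_prod, lintegral_map hF measurable_prodMk_left, ← smul_eq_mul,
    ← lintegral_smul_measure, h.inv_smul_law,
    lintegral_withDensity_eq_lintegral_mul _ (h.measurable x).ennreal_ofReal hFx]
  rfl

lemma jointLaw_eq (h : HasChannelDensity W ν q) [IsFiniteMeasure ν] :
    jointLaw W = ∑ x, (ν.withDensity fun y => ENNReal.ofReal (q x y)).map (Prod.mk x) := by
  refine Measure.ext_of_lintegral _ fun F hF => ?_
  rw [h.lintegral_jointLaw hF, lintegral_finsetSum_measure]
  refine Finset.sum_congr rfl fun x _ => ?_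
  have hFx : Measurable fun y => F (x, y) := hF.comp measurable_prodMk_left
  rw [lintegral_map hF measurable_prodMk_left,
    lintegral_withDensity_eq_lintegral_mul _ (h.measurable x).ennreal_ofReal hFx]
  rfl

lemma integral_jointLaw (h : HasChannelDensity W ν q) [IsFiniteMeasure ν]
    {F : Input m × Y → ℝ} (hF : Measurable F)
    (hint : ∀ x, Integrable (fun y => q x y * F (x, y)) ν) :
    ∫ p, F p ∂(jointLaw W) = ∑ x, ∫ y, q x y * F (x, y) ∂ν := by
  have hx (x : Input m) : Integrable F
      ((ν.withDensity fun y => ENNReal.ofReal (q x y)).map (Prod.mk x)) := by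
    rw [integrable_map_measure hF.aestronglyMeasurable measurable_prodMk_left.aemeasurable,
      integrable_withDensity_iff (h.measurable x).ennreal_ofReal (by simp)]
    refine (hint x).congr (Eventually.of_forall fun y => ?_)
    simp [ENNReal.toReal_ofReal (h.nonneg x y), mul_comm]
  rw [h.jointLaw_eq, integral_finsetSum_measure fun x _ => hx x]
  refine Finset.sum_congr rfl fun x _ => ?_
  rw [integral_map measurable_prodMk_left.aemeasurable hF.aestronglyMeasurable,
    integral_withDensity_eq_integral_toReal_smul (h.measurable x).ennreal_ofReal (by simp)]
  simp only [ENNReal.toReal_ofReal (h.nonneg x _), smul_eq_mul]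

/-- After splitting the input into X[J] and X[Jᶜ], the likelihood ratio is 2^|J| times `q` over its
marginal on (Y, X[Jᶜ]). The mean of its logarithm gives the three terms, the first because `q` has
total mass 1. -/
lemma channelInfo_mul_log_two (h : HasChannelDensity W ν q) [IsFiniteMeasure ν]
    [∀ x, IsProbabilityMeasure (W x)] (J : Finset (Fin m)) :
    channelInfo W J * Real.log 2 = J.card * Real.log 2 -
      (outputEntropy ν q (restrictInput Finset.univ) - outputEntropy ν q (restrictInput Jᶜ)) := by
  have hlog : Real.log 2 ≠ 0 := (Real.log_pos one_lt_two).ne'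
  rw [channelInfo, mutualInfo, div_mul_cancel₀ _ hlog]
  let e := Equiv.piEquivPiSubtypeProd (fun i => i ∈ J) (fun _ : Fin m => ZMod 2)
  set r : ({i // i ∈ J} → ZMod 2) → ({i // i ∉ J} → ZMod 2) → Y → ℝ :=
    fun a b => q (e.symm (a, b)) with hr
  have hrm : ∀ a b, Measurable (r a b) := fun a b => h.measurable _
  have hr0 : ∀ a b y, 0 ≤ r a b y := fun a b => h.nonneg _
  set Φ : Input m × Y → ({i // i ∈ J} → ZMod 2) × (Y × ({i // i ∉ J} → ZMod 2)) :=
    fun p => (fun i => p.1 i, (p.2, fun i => p.1 i)) with hΦ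
  have hΦm : Measurable Φ := by
    refine Measurable.prodMk ?_ (measurable_snd.prodMk ?_)
    · exact measurable_pi_lambda _ fun i => (measurable_pi_apply _).comp measurable_fst
    · exact measurable_pi_lambda _ fun i => (measurable_pi_apply _).comp measurable_fst
  have hmap : (jointLaw W).map Φ = densityMeasure ν r := by
    refine Measure.ext_of_lintegral _ fun F hF => ?_
    rw [lintegral_map hF hΦm, h.lintegral_jointLaw (F := fun p => F (Φ p)) (hF.comp hΦm),
      lintegral_densityMeasure ν hrm hF, ← Fintype.sum_prod_type',
      ← Equiv.sum_comp e]
    refine Finset.sum_congr rfl fun x _ => ?_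
    simp only [hr, Prod.mk.eta, Equiv.symm_apply_apply]
    rfl
  have hfst : (jointLaw W).map (fun p => fun i : {i // i ∈ J} => p.1 i) =
      (densityMeasure ν r).map Prod.fst := by
    rw [← hmap, Measure.map_map measurable_fst hΦm]; rfl
  have hsnd : (jointLaw W).map (fun p => (p.2, fun i : {i // i ∉ J} => p.1 i)) =
      (densityMeasure ν r).map Prod.snd := by
    rw [← hmap, Measure.map_map measurable_snd hΦm]; rfl
  have hcard : (Fintype.card ({i // i ∈ J} → ZMod 2) : ℝ) = 2 ^ J.card := by simp
  have hc : ∀ a, ∑ b, ∫⁻ y, ENNReal.ofReal (r a b y) ∂ν =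
      (Fintype.card ({i // i ∈ J} → ZMod 2) : ℝ≥0∞)⁻¹ := by
    intro a
    simp only [hr, h.lintegral_eq]
    have h1 : Fintype.card ({i // i ∈ J} → ZMod 2) * Fintype.card ({i // i ∉ J} → ZMod 2) =
        2 ^ m := by
      rw [← Fintype.card_prod, ← Fintype.card_congr e]; simp
    have h2 : (2 : ℝ≥0∞) ^ m = Fintype.card ({i // i ∈ J} → ZMod 2) *
        Fintype.card ({i // i ∉ J} → ZMod 2) := by exact_mod_cast h1.symm
    have h3 : (Fintype.card ({i // i ∉ J} → ZMod 2) : ℝ≥0∞) ≠ 0 := by simp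
    have h4 : (Fintype.card ({i // i ∉ J} → ZMod 2) : ℝ≥0∞) ≠ ∞ := ENNReal.natCast_ne_top _
    rw [Finset.sum_const, Finset.card_univ, nsmul_eq_mul, h2,
      ENNReal.mul_inv (Or.inr h4) (Or.inr h3), mul_comm, mul_assoc,
      ENNReal.inv_mul_cancel h3 h4, mul_one]
  rw [hfst, hsnd, show (jointLaw W).map (fun p => ((fun i : {i // i ∈ J} => p.1 i),
    (p.2, fun i : {i // i ∉ J} => p.1 i))) = densityMeasure ν r from hmap,
    toReal_klDiv_densityMeasure ν hrm hr0 hc, ← hmap]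
  have hsm : Measurable fun z : ({i // i ∈ J} → ZMod 2) × (Y × ({i // i ∉ J} → ZMod 2)) =>
      ∑ a, r a z.2.2 z.2.1 := Finset.measurable_sum _ fun a _ =>
    (measurable_uncurry_density hrm).comp (measurable_prodMk_left.comp measurable_snd)
  have hLm : Measurable fun z : ({i // i ∈ J} → ZMod 2) × (Y × ({i // i ∉ J} → ZMod 2)) =>
      Real.log (Fintype.card ({i // i ∈ J} → ZMod 2) * r z.1 z.2.2 z.2.1 /
        ∑ a, r a z.2.2 z.2.1) :=
    (((measurable_uncurry_density hrm).const_mul _).div hsm).log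
  rw [integral_map hΦm.aemeasurable hLm.aestronglyMeasurable]
  have hmarg (x : Input m) (y : Y) : ∑ a, r a (fun i : {i // i ∉ J} => x i) y =
      fiberMass (fun x => q x y) (restrictInput Jᶜ) (restrictInput Jᶜ x) := by
    classical
    simp only [fiberMass, hr]
    rw [← Equiv.sum_comp e.symm, Fintype.sum_prod_type]
    refine Finset.sum_congr rfl fun a _ => ?_
    rw [Finset.sum_eq_single fun i : {i // i ∉ J} => x i]
    · rw [if_pos]
      rw [restrictInput_eq_iff]
      intro i hi
      have := congrFun (congrArg Prod.snd (e.apply_symm_apply (a, fun i : {i // i ∉ J} => x i)))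
        ⟨i, by simpa using hi⟩
      exact this
    · intro b _ hb
      rw [if_neg]
      intro h'
      rw [restrictInput_eq_iff] at h'
      refine hb (funext fun i => ?_)
      rw [← h' i (by simpa using i.2)]
      exact (congrFun (congrArg Prod.snd (e.apply_symm_apply (a, b))) i).symm
    · simp
  have huniv (x : Input m) (y : Y) : q x y =
      fiberMass (fun x => q x y) (restrictInput Finset.univ) (restrictInput Finset.univ x) := by
    classical
    have (x' : Input m) : restrictInput Finset.univ x' = restrictInput Finset.univ x ↔ x' = x := by
      rw [restrictInput_eq_iff, funext_iff]; simp
    simp [fiberMass, this]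
  have hterm (x : Input m) (y : Y) : q x y * Real.log (Fintype.card ({i // i ∈ J} → ZMod 2) *
        r (Φ (x, y)).1 (Φ (x, y)).2.2 (Φ (x, y)).2.1 / ∑ a, r a (Φ (x, y)).2.2 (Φ (x, y)).2.1) =
      J.card * Real.log 2 * q x y + q x y * Real.log (fiberMass (fun x => q x y)
        (restrictInput Finset.univ) (restrictInput Finset.univ x)) -
      q x y * Real.log (fiberMass (fun x => q x y) (restrictInput Jᶜ) (restrictInput Jᶜ x)) := by
    have h1 : r (Φ (x, y)).1 (Φ (x, y)).2.2 (Φ (x, y)).2.1 = q x y :=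
      congrArg (fun x => q x y) (e.symm_apply_apply x)
    have h2 : ∑ a, r a (Φ (x, y)).2.2 (Φ (x, y)).2.1 =
        fiberMass (fun x => q x y) (restrictInput Jᶜ) (restrictInput Jᶜ x) := hmarg x y
    rw [h1, h2, ← huniv]
    rcases (h.nonneg x y).eq_or_lt with h0 | h0
    · simp [← h0]
    have h3 := h0.trans_le (le_fiberMass (fun x => h.nonneg x y) (restrictInput Jᶜ) x)
    rw [Real.log_div (mul_pos (by rw [hcard]; positivity) h0).ne' h3.ne',
      Real.log_mul (by rw [hcard]; positivity) h0.ne', hcard, Real.log_pow]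
    ring
  have hi1 (x : Input m) := h.integrable_mul_log ν (restrictInput (m := m) Finset.univ) x
  have hi2 (x : Input m) := h.integrable_mul_log ν (restrictInput Jᶜ) x
  have hi3 (x : Input m) := (h.integrable ν x).const_mul (J.card * Real.log 2)
  refine (h.integral_jointLaw (hLm.comp hΦm) fun x =>
    (((hi3 x).add (hi1 x)).sub (hi2 x)).congr
      (Eventually.of_forall fun y => (hterm x y).symm)).trans ?_
  refine (Finset.sum_congr rfl fun x _ =>
    integral_congr_ae (Eventually.of_forall (hterm x))).trans ?_
  have hsplit (x : Input m) := (integral_sub ((hi3 x).add (hi1 x)) (hi2 x)).trans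
    (congrArg (· - _) (integral_add (hi3 x) (hi1 x)))
  simp only [Pi.add_apply] at hsplit
  simp only [hsplit, Finset.sum_sub_distrib, Finset.sum_add_distrib]
  have hone : ∑ x, ∫ y, J.card * Real.log 2 * q x y ∂ν = J.card * Real.log 2 := by
    simp only [integral_const_mul]
    rw [← Finset.mul_sum, ← integral_finsetSum _ fun x _ => h.integrable ν x,
      h.integral_sum_eq_one, mul_one]
  rw [hone]
  simp only [outputEntropy, fiberEntropy, integral_neg]
  rw [integral_finsetSum _ fun x _ => hi1 x, integral_finsetSum _ fun x _ => hi2 x]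
  ring

end HasChannelDensity

end ChannelDensity

/-! ### Densities and entropies of the transformed channels -/

section DensityOfTransforms

variable {m : ℕ} {Y β γ : Type*}

/-- Every channel has a density with respect to a finite measure. -/
lemma exists_hasChannelDensity [MeasurableSpace Y] (W : Input m → Measure Y) [∀ x, IsProbabilityMeasure (W x)] :
    ∃ (ν : Measure Y) (q : Input m → Y → ℝ), IsFiniteMeasure ν ∧ HasChannelDensity W ν q := by
  set ν : Measure Y := ∑ x, W x with hν
  have hfin : IsFiniteMeasure ν := by
    constructor
    simp [hν, Measure.finsetSum_apply]
  have hle (x : Input m) : W x ≤ ν := by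
    rw [Measure.le_iff]
    intro s _
    rw [hν, Measure.finsetSum_apply]
    exact Finset.single_le_sum (f := fun x => W x s) (fun _ _ => zero_le) (Finset.mem_univ x)
  have hmeas (x : Input m) : Measurable fun y => min ((W x).rnDeriv ν y) 1 :=
    (Measure.measurable_rnDeriv _ _).min measurable_const
  have hpow : (0 : ℝ) < 2 ^ m := by positivity
  -- The derivative is at most 1 only almost everywhere. Truncation makes the bound on the sum of
  -- the weights hold at every `y` without changing the measure.
  refine ⟨ν, fun x y => (min ((W x).rnDeriv ν y) 1).toReal / 2 ^ m, hfin,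
    ⟨fun x => (hmeas x).ennreal_toReal.div_const _, fun x y => by positivity, fun y => ?_⟩,
    fun x => ?_⟩
  · rw [← Finset.sum_div, div_le_one hpow]
    calc ∑ x : Input m, (min ((W x).rnDeriv ν y) 1).toReal ≤ ∑ _x : Input m, (1 : ℝ) :=
          Finset.sum_le_sum fun x _ => by
            simpa using ENNReal.toReal_mono ENNReal.one_ne_top
              (min_le_right ((W x).rnDeriv ν y) 1)
      _ = 2 ^ m := by simp
  · have h1 : (fun y => ENNReal.ofReal ((min ((W x).rnDeriv ν y) 1).toReal / 2 ^ m)) =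
        ((2 : ℝ≥0∞) ^ m)⁻¹ • fun y => min ((W x).rnDeriv ν y) 1 := by
      funext y
      have : min ((W x).rnDeriv ν y) 1 ≠ ∞ := (min_le_right _ _).trans_lt ENNReal.one_lt_top |>.ne
      rw [ENNReal.ofReal_div_of_pos hpow, ENNReal.ofReal_toReal this, Pi.smul_apply, smul_eq_mul,
        ENNReal.ofReal_pow two_pos.le, ENNReal.ofReal_ofNat, div_eq_mul_inv, mul_comm]
    rw [h1, withDensity_smul _ (hmeas x), smul_smul,
      ENNReal.mul_inv_cancel HasChannelDensity.two_pow_ne_zero HasChannelDensity.two_pow_ne_top,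
      one_smul]
    have h2 : (fun y => min ((W x).rnDeriv ν y) 1) =ᵐ[ν] (W x).rnDeriv ν := by
      filter_upwards [Measure.rnDeriv_le_one_of_le (hle x)] with y hy
      exact min_eq_left hy
    rw [withDensity_congr_ae h2,
      Measure.withDensity_rnDeriv_eq _ _ (Measure.absolutelyContinuous_of_le (hle x))]

/-- The joint density of two inputs `u₁`, `u₂` and the outputs of two uses of a channel on
`u₁ + u₂` and `u₂`. -/
def pairDensity (q : Input m → Y → ℝ) (p : Input m × Input m) (y : Y × Y) : ℝ :=
  q (p.1 + p.2) y.1 * q p.2 y.2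

/-- The density of the channel `W⁻`. -/
def minusDensity (q : Input m → Y → ℝ) (u₁ : Input m) (y : Y × Y) : ℝ :=
  ∑ u₂, pairDensity q (u₁, u₂) y

/-- The density of the channel `W⁺`. -/
def plusDensity (q : Input m → Y → ℝ) (u₂ : Input m) (z : (Y × Y) × Input m) : ℝ :=
  pairDensity q (z.2, u₂) z.1

variable {q : Input m → Y → ℝ}

lemma input_add_self (x : Input m) : x + x = 0 := by
  funext i
  simp only [Pi.add_apply, Pi.zero_apply]
  generalize x i = z
  revert z
  decide

/-- The change of variables `(u₁, u₂) ↦ (u₁ + u₂, u₂)`. -/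
def addSndEquiv (m : ℕ) : Input m × Input m ≃ Input m × Input m where
  toFun p := (p.1 + p.2, p.2)
  invFun p := (p.1 + p.2, p.2)
  left_inv p := by simp [add_assoc, input_add_self]
  right_inv p := by simp [add_assoc, input_add_self]

lemma sum_pairDensity (q : Input m → Y → ℝ) (y : Y × Y) :
    ∑ p, pairDensity q p y = (∑ x, q x y.1) * ∑ x, q x y.2 := by
  rw [Finset.sum_mul_sum, ← Fintype.sum_prod_type']
  exact Equiv.sum_comp (addSndEquiv m) fun p => q p.1 y.1 * q p.2 y.2

lemma fiberEntropy_pairDensity (q : Input m → Y → ℝ) (y : Y × Y) (f : Input m × Input m → β) :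
    fiberEntropy (fun p => pairDensity q p y) (fun p => f (p.1 + p.2, p.2)) =
      fiberEntropy (fun p : Input m × Input m => q p.1 y.1 * q p.2 y.2) f :=
  fiberEntropy_comp_equiv (addSndEquiv m) (fun p => q p.1 y.1 * q p.2 y.2) f

variable [MeasurableSpace Y]

lemma IsSubprobWeight.pairDensity (hq : IsSubprobWeight q) :
    IsSubprobWeight (pairDensity q) where
  measurable p := ((hq.measurable _).comp measurable_fst).mul
    ((hq.measurable _).comp measurable_snd)
  nonneg p y := mul_nonneg (hq.nonneg _ _) (hq.nonneg _ _)
  sum_le y := by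
    rw [sum_pairDensity]
    exact mul_le_one₀ (hq.sum_le _) (Finset.sum_nonneg fun x _ => hq.nonneg x _) (hq.sum_le _)

lemma IsSubprobWeight.minusDensity (hq : IsSubprobWeight q) :
    IsSubprobWeight (minusDensity q) where
  measurable u := Finset.measurable_sum _ fun u₂ _ => hq.pairDensity.measurable (u, u₂)
  nonneg u y := Finset.sum_nonneg fun u₂ _ => hq.pairDensity.nonneg (u, u₂) y
  sum_le y := by
    simp only [_root_.minusDensity]
    exact (Fintype.sum_prod_type fun p => _root_.pairDensity q p y).symm.trans_le
      (hq.pairDensity.sum_le y)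

lemma IsSubprobWeight.plusDensity (hq : IsSubprobWeight q) :
    IsSubprobWeight (plusDensity q) where
  measurable u := by
    have h : Measurable fun w : Input m × (Y × Y) => _root_.pairDensity q (w.1, u) w.2 :=
      measurable_from_prod_countable_right fun u₁ => hq.pairDensity.measurable (u₁, u)
    exact h.comp (measurable_snd.prodMk measurable_fst)
  nonneg u z := hq.pairDensity.nonneg (z.2, u) z.1
  sum_le z := by
    refine le_trans ?_ (hq.pairDensity.sum_le z.1)
    rw [Fintype.sum_prod_type]
    exact Finset.single_le_sum (f := fun u₁ => ∑ u₂, _root_.pairDensity q (u₁, u₂) z.1)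
      (fun u₁ _ => Finset.sum_nonneg fun u₂ _ => hq.pairDensity.nonneg _ _) (Finset.mem_univ z.2)

variable {W : Input m → Measure Y} {ν : Measure Y} [IsFiniteMeasure ν]

lemma HasChannelDensity.prod_law (h : HasChannelDensity W ν q) (u₁ u₂ : Input m) :
    (W (u₁ + u₂)).prod (W u₂) = ((2 : ℝ≥0∞) ^ m * 2 ^ m) •
      (ν.prod ν).withDensity fun y => ENNReal.ofReal (_root_.pairDensity q (u₁, u₂) y) := by
  rw [h.law_eq, h.law_eq u₂, Measure.prod_smul_left, Measure.prod_smul_right, smul_smul,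
    prod_withDensity (h.measurable _).ennreal_ofReal (h.measurable _).ennreal_ofReal]
  simp only [_root_.pairDensity, ENNReal.ofReal_mul (h.nonneg _ _)]

lemma two_pow_inv_mul (m : ℕ) :
    ((2 : ℝ≥0∞) ^ m)⁻¹ * ((2 : ℝ≥0∞) ^ m * 2 ^ m) = 2 ^ m := by
  rw [← mul_assoc, ENNReal.inv_mul_cancel HasChannelDensity.two_pow_ne_zero
    HasChannelDensity.two_pow_ne_top, one_mul]

lemma HasChannelDensity.minus (h : HasChannelDensity W ν q) :
    HasChannelDensity (minusLaw W) (ν.prod ν) (minusDensity q) where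
  toIsSubprobWeight := h.toIsSubprobWeight.minusDensity
  law_eq u := by
    have hp := h.toIsSubprobWeight.pairDensity
    refine Measure.ext_of_lintegral _ fun F hF => ?_
    rw [minusLaw, uniformMix]
    simp only [h.prod_law]
    rw [← Finset.smul_sum, smul_smul, two_pow_inv_mul, lintegral_smul_measure,
      lintegral_smul_measure, lintegral_finsetSum_measure,
      lintegral_withDensity_eq_lintegral_mul _
        (h.toIsSubprobWeight.minusDensity.measurable u).ennreal_ofReal hF]
    congr 1
    have hm (u₂ : Input m) := (hp.measurable (u, u₂)).ennreal_ofReal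
    simp only [lintegral_withDensity_eq_lintegral_mul _ (hm _) hF]
    rw [← lintegral_finsetSum _ fun u₂ _ => (hm u₂).mul hF]
    refine lintegral_congr fun y => ?_
    simp only [Pi.mul_apply, minusDensity]
    rw [ENNReal.ofReal_sum_of_nonneg fun u₂ _ => hp.nonneg _ _, Finset.sum_mul]

lemma HasChannelDensity.plus (h : HasChannelDensity W ν q) :
    HasChannelDensity (plusLaw W) ((ν.prod ν).prod (Measure.count : Measure (Input m)))
      (plusDensity q) where
  toIsSubprobWeight := h.toIsSubprobWeight.plusDensity
  law_eq u := by
    have hp := h.toIsSubprobWeight.pairDensity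
    have hpl := (h.toIsSubprobWeight.plusDensity.measurable u).ennreal_ofReal
    refine Measure.ext_of_lintegral _ fun F hF => ?_
    rw [plusLaw, uniformMix]
    simp only [h.prod_law]
    simp only [Measure.prod_smul_left]
    rw [← Finset.smul_sum, smul_smul, two_pow_inv_mul, lintegral_smul_measure,
      lintegral_smul_measure, lintegral_finsetSum_measure,
      lintegral_withDensity_eq_lintegral_mul _ hpl hF,
      lintegral_prod _ (hpl.mul hF).aemeasurable]
    congr 1
    simp only [lintegral_count, tsum_fintype]
    have hm (u₁ : Input m) : Measurable fun y : Y × Y =>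
        ENNReal.ofReal (pairDensity q (u₁, u) y) * F (y, u₁) :=
      (hp.measurable (u₁, u)).ennreal_ofReal.mul (hF.comp measurable_prodMk_right)
    refine Eq.trans ?_ (lintegral_finsetSum _ fun u₁ _ => hm u₁).symm
    refine Finset.sum_congr rfl fun u₁ _ => ?_
    have hFu : Measurable fun y => F (y, u₁) := hF.comp measurable_prodMk_right
    rw [Measure.prod_dirac, lintegral_map hF measurable_prodMk_right,
      lintegral_withDensity_eq_lintegral_mul _ (hp.measurable (u₁, u)).ennreal_ofReal hFu]
    rfl

/-- Summing out `u₂` is marginalisation, so P⁻ is read off from the pair density by not observing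
`u₂`. -/
lemma outputEntropy_minusDensity (ν : Measure (Y × Y)) (q : Input m → Y → ℝ) (f : Input m → β) :
    outputEntropy ν (minusDensity q) f = outputEntropy ν (pairDensity q) fun p => f p.1 := by
  simp only [outputEntropy, minusDensity]
  exact integral_congr_ae (Eventually.of_forall fun y =>
    (fiberEntropy_comp_fst (fun p => pairDensity q p y) f).symm)

/-- As `u₁` is an output of P⁺, integrating it against counting measure amounts to including it
among the observed variables. -/
lemma outputEntropy_plusDensity (hq : IsSubprobWeight q) (f : Input m → β) :
    outputEntropy ((ν.prod ν).prod (Measure.count : Measure (Input m))) (plusDensity q) f =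
      outputEntropy (ν.prod ν) (pairDensity q) fun p => (p.1, f p.2) := by
  rw [outputEntropy, integral_prod _ (hq.plusDensity.integrable_fiberEntropy _ f), outputEntropy]
  refine integral_congr_ae (Eventually.of_forall fun y => ?_)
  simp only [integral_count]
  exact (fiberEntropy_fst_prod (fun p => pairDensity q p y) f).symm

/-- In the coordinates x₁ = u₁ + u₂, x₂ = u₂ the two channel uses are independent, so entropies add.
The masses left over by the unnormalised weights integrate to 1. -/
lemma outputEntropy_pairDensity (hq : IsSubprobWeight q) (hone : ∫ y, ∑ x, q x y ∂ν = 1)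
    (f : Input m → β) (g : Input m → γ) :
    outputEntropy (ν.prod ν) (pairDensity q) (fun p => (f (p.1 + p.2), g p.2)) =
      outputEntropy ν q f + outputEntropy ν q g := by
  have h (y : Y × Y) : fiberEntropy (fun p => pairDensity q p y)
      (fun p => (f (p.1 + p.2), g p.2)) =
      fiberEntropy (fun x => q x y.1) f * (∑ x, q x y.2) +
        (∑ x, q x y.1) * fiberEntropy (fun x => q x y.2) g := by
    rw [fiberEntropy_pairDensity q y fun p => (f p.1, g p.2),
      fiberEntropy_prodMap (fun x => hq.nonneg x _) (fun x => hq.nonneg x _),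
      mul_comm (∑ x, q x y.2)]
  simp only [outputEntropy, h]
  rw [integral_add ((hq.integrable_fiberEntropy ν f).mul_prod (hq.integrable_sum ν))
    ((hq.integrable_sum ν).mul_prod (hq.integrable_fiberEntropy ν g)),
    integral_prod_mul (fun y => fiberEntropy (fun x => q x y) f) fun y => ∑ x, q x y,
    integral_prod_mul (fun y => ∑ x, q x y) fun y => fiberEntropy (fun x => q x y) g, hone]
  ring

end DensityOfTransforms

/-! ### One polarization step at the level of entropies -/

section OneStep

variable {m : ℕ} {X Y β γ δ : Type*} [Fintype X] [MeasurableSpace Y]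

/-! ### Inequalities between output entropies -/

lemma outputEntropy_congr (ν : Measure Y) (q : X → Y → ℝ) {f : X → β} {g : X → γ}
    (h : ∀ x x', f x = f x' ↔ g x = g x') : outputEntropy ν q f = outputEntropy ν q g := by
  simp only [outputEntropy, fiberEntropy_congr _ h]

variable {q : X → Y → ℝ} (ν : Measure Y) [IsFiniteMeasure ν]

lemma outputEntropy_mono (hq : IsSubprobWeight q) {f : X → β} {g : X → γ}
    (h : ∀ x x', f x = f x' → g x = g x') : outputEntropy ν q g ≤ outputEntropy ν q f :=
  integral_mono (hq.integrable_fiberEntropy ν g) (hq.integrable_fiberEntropy ν f) fun y =>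
    fiberEntropy_mono (fun x => hq.nonneg x y) h

lemma outputEntropy_submodular [Fintype β] [Fintype γ] [Fintype δ] (hq : IsSubprobWeight q)
    (f : X → β) (g : X → γ) (k : X → δ) :
    outputEntropy ν q (fun x => (f x, g x, k x)) + outputEntropy ν q k ≤
      outputEntropy ν q (fun x => (f x, k x)) + outputEntropy ν q (fun x => (g x, k x)) := by
  have hi := hq.integrable_fiberEntropy ν (fun x => (f x, g x, k x))
  have hi1 := hq.integrable_fiberEntropy ν k
  have hi2 := hq.integrable_fiberEntropy ν (fun x => (f x, k x))
  have hi3 := hq.integrable_fiberEntropy ν (fun x => (g x, k x))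
  simp only [outputEntropy]
  rw [← integral_add hi hi1, ← integral_add hi2 hi3]
  exact integral_mono (hi.add hi1) (hi2.add hi3) fun y =>
    fiberEntropy_submodular (fun x => hq.nonneg x y) f g k

lemma restrictInput_univ_eq_iff (x x' : Input m) :
    restrictInput Finset.univ x = restrictInput Finset.univ x' ↔ x = x' := by
  rw [restrictInput_eq_iff, funext_iff]; simp

lemma restrictInput_insert_eq_iff (i : Fin m) (A : Finset (Fin m)) (x x' : Input m) :
    restrictInput (insert i A) x = restrictInput (insert i A) x' ↔
      restrictInput A x = restrictInput A x' ∧ x i = x' i := by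
  simp only [restrictInput_eq_iff, Finset.forall_mem_insert]
  tauto

lemma restrictInput_add (A : Finset (Fin m)) (x y : Input m) :
    restrictInput A (x + y) = restrictInput A x + restrictInput A y := rfl

variable {q : Input m → Y → ℝ}

/-- Submodularity of the joint entropy of the output and a set of inputs. -/
lemma outputEntropy_restrictInput_submodular (hq : IsSubprobWeight q) (A B : Finset (Fin m)) :
    outputEntropy ν q (restrictInput (A ∪ B)) + outputEntropy ν q (restrictInput (A ∩ B)) ≤
      outputEntropy ν q (restrictInput A) + outputEntropy ν q (restrictInput B) := by
  have h := outputEntropy_submodular ν hq (restrictInput A) (restrictInput B)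
    (restrictInput (A ∩ B))
  rw [outputEntropy_congr ν q (g := restrictInput (A ∪ B)),
    outputEntropy_congr ν q (f := fun x => (restrictInput A x, restrictInput (A ∩ B) x))
      (g := restrictInput A),
    outputEntropy_congr ν q (f := fun x => (restrictInput B x, restrictInput (A ∩ B) x))
      (g := restrictInput B)] at h
  · exact h
  all_goals
    intro x x'
    simp only [Prod.mk.injEq, restrictInput_eq_iff, Finset.mem_union, Finset.mem_inter]
    grind

lemma add_left_input_iff {A : Type*} [AddCommGroup A] {a b c d : A} (h : b = d) :
    a + b = c + d ↔ a = c := by rw [h, add_left_inj]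

/-- One step of polarization increases the sum of the conditional entropies. -/
lemma two_mul_sub_outputEntropy_le (hq : IsSubprobWeight q)
    (hone : ∫ y, ∑ x, q x y ∂ν = 1) (A : Finset (Fin m)) :
    2 * (outputEntropy ν q (restrictInput Finset.univ) - outputEntropy ν q (restrictInput A)) ≤
      (outputEntropy (ν.prod ν) (minusDensity q) (restrictInput Finset.univ) -
        outputEntropy (ν.prod ν) (minusDensity q) (restrictInput A)) +
      (outputEntropy ((ν.prod ν).prod Measure.count) (plusDensity q) (restrictInput Finset.univ) -
        outputEntropy ((ν.prod ν).prod Measure.count) (plusDensity q) (restrictInput A)) := by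
  have hp := hq.pairDensity
  simp only [outputEntropy_minusDensity, outputEntropy_plusDensity hq]
  -- Given the outputs and u₁[A], also learning the rest of u₁ cannot raise the conditional entropy
  -- of u₂[A].
  have h := outputEntropy_submodular (ν.prod ν) hp Prod.fst (fun p => restrictInput A p.2)
    (fun p => restrictInput A p.1)
  have e1 : outputEntropy (ν.prod ν) (pairDensity q)
      (fun p => (p.1, restrictInput A p.2, restrictInput A p.1)) =
      outputEntropy (ν.prod ν) (pairDensity q) (fun p => (p.1, restrictInput A p.2)) :=
    outputEntropy_congr _ _ fun x x' => by
      simp only [Prod.mk.injEq]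
      exact ⟨fun h => ⟨h.1, h.2.1⟩, fun h => ⟨h.1, h.2, by rw [h.1]⟩⟩
  have e2 : outputEntropy (ν.prod ν) (pairDensity q) (fun p => (p.1, restrictInput A p.1)) =
      outputEntropy (ν.prod ν) (pairDensity q) (fun p => restrictInput Finset.univ p.1) :=
    outputEntropy_congr _ _ fun x x' => by
      simp only [Prod.mk.injEq, restrictInput_univ_eq_iff]
      exact ⟨fun h => h.1, fun h => ⟨h, by rw [h]⟩⟩
  have e3 : outputEntropy (ν.prod ν) (pairDensity q)
      (fun p => (restrictInput A p.2, restrictInput A p.1)) =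
      outputEntropy ν q (restrictInput A) + outputEntropy ν q (restrictInput A) := by
    rw [← outputEntropy_pairDensity hq hone]
    exact outputEntropy_congr _ _ fun x x' => by
      simp only [Prod.mk.injEq, restrictInput_add]
      exact ⟨fun h => ⟨by rw [h.1, h.2], h.1⟩, fun h => ⟨h.2, (add_left_input_iff h.2).1 h.1⟩⟩
  have e4 : outputEntropy (ν.prod ν) (pairDensity q)
      (fun p => (p.1, restrictInput Finset.univ p.2)) =
      outputEntropy ν q (restrictInput Finset.univ) +
        outputEntropy ν q (restrictInput Finset.univ) := by
    rw [← outputEntropy_pairDensity hq hone]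
    exact outputEntropy_congr _ _ fun x x' => by
      simp only [Prod.mk.injEq, restrictInput_univ_eq_iff]
      exact ⟨fun h => ⟨by rw [h.1, h.2], h.2⟩, fun h => ⟨(add_left_input_iff h.2).1 h.1, h.2⟩⟩
  rw [e1, e2, e3] at h
  rw [e4]
  linarith

/-! ### The conditional entropy of a single input -/

/-- The conditional entropy of the input of user `i` given the output and the inputs in `A`. -/
noncomputable def bitEntropy (ν : Measure Y) (q : Input m → Y → ℝ) (A : Finset (Fin m))
    (i : Fin m) : ℝ :=
  outputEntropy ν q (restrictInput (insert i A)) - outputEntropy ν q (restrictInput A)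

/-- The squared Bhattacharyya parameter of user `i` given the output and the inputs in `A`. -/
noncomputable def bitBhattacharyya (ν : Measure Y) (q : Input m → Y → ℝ) (A : Finset (Fin m))
    (i : Fin m) : ℝ :=
  ∫ y, fiberBhattacharyya (fun x => q x y) (restrictInput A) (fun x => x i) ∂ν

lemma bitEntropy_eq_integral (hq : IsSubprobWeight q) (A : Finset (Fin m)) (i : Fin m) :
    bitEntropy ν q A i = ∫ y, (fiberEntropy (fun x => q x y) (fun x => (restrictInput A x, x i)) -
      fiberEntropy (fun x => q x y) (restrictInput A)) ∂ν := by
  rw [integral_sub (hq.integrable_fiberEntropy ν _) (hq.integrable_fiberEntropy ν _), bitEntropy]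
  congr 1
  exact outputEntropy_congr ν q fun x x' => by
    rw [restrictInput_insert_eq_iff, Prod.mk.injEq]

lemma integrable_fiberBhattacharyya (hq : IsSubprobWeight q) (A : Finset (Fin m)) (i : Fin m) :
    Integrable (fun y => fiberBhattacharyya (fun x => q x y) (restrictInput A) (fun x => x i))
      ν := by
  refine Integrable.of_bound (C := 1) ?_ (Eventually.of_forall fun y => ?_)
  · refine (Finset.measurable_sum _ fun b _ => ?_).aestronglyMeasurable
    have h (c : ZMod 2) := hq.measurable_fiberMass (fun x => (restrictInput A x, x i)) (b, c)
    exact (((h 0).const_mul 4).mul (h 1)).div ((h 0).add (h 1))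
  · rw [Real.norm_of_nonneg (fiberBhattacharyya_nonneg (fun x => hq.nonneg x y) _ _)]
    exact (fiberBhattacharyya_le (fun x => hq.nonneg x y) _ _).trans (hq.sum_le y)

lemma bitBhattacharyya_nonneg (ρ : Measure Y) (hq : IsSubprobWeight q) (A : Finset (Fin m))
    (i : Fin m) : 0 ≤ bitBhattacharyya ρ q A i :=
  integral_nonneg fun y => fiberBhattacharyya_nonneg (fun x => hq.nonneg x y) _ _

lemma bitEntropy_nonneg (hq : IsSubprobWeight q) (A : Finset (Fin m)) (i : Fin m) :
    0 ≤ bitEntropy ν q A i :=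
  sub_nonneg.2 (outputEntropy_mono ν hq fun x x' h =>
    ((restrictInput_insert_eq_iff i A x x').1 h).1)

lemma bitEntropy_le_log_two (hq : IsSubprobWeight q) (hone : ∫ y, ∑ x, q x y ∂ν = 1)
    (A : Finset (Fin m)) (i : Fin m) : bitEntropy ν q A i ≤ Real.log 2 := by
  rw [bitEntropy_eq_integral ν hq]
  calc _ ≤ ∫ y, Real.log 2 * ∑ x, q x y ∂ν :=
        integral_mono ((hq.integrable_fiberEntropy ν _).sub (hq.integrable_fiberEntropy ν _))
          ((hq.integrable_sum ν).const_mul _) fun y =>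
            fiberEntropy_prod_bit_le_log_two (fun x => hq.nonneg x y) _ _
    _ = Real.log 2 := by rw [integral_const_mul, hone, mul_one]

lemma bitEntropy_le_add_div (hq : IsSubprobWeight q) (hone : ∫ y, ∑ x, q x y ∂ν = 1)
    (A : Finset (Fin m)) (i : Fin m) {ε : ℝ} (hε : 0 < ε) :
    bitEntropy ν q A i ≤ ε + bitBhattacharyya ν q A i / ε := by
  have hb := integrable_fiberBhattacharyya ν hq A i
  rw [bitEntropy_eq_integral ν hq]
  calc _ ≤ ∫ y, (ε * ∑ x, q x y +
          fiberBhattacharyya (fun x => q x y) (restrictInput A) (fun x => x i) / ε) ∂ν :=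
        integral_mono ((hq.integrable_fiberEntropy ν _).sub (hq.integrable_fiberEntropy ν _))
          (((hq.integrable_sum ν).const_mul _).add (hb.div_const _)) fun y =>
            fiberEntropy_prod_bit_le_add_div hε (fun x => hq.nonneg x y) _ _
    _ = _ := by
      rw [integral_add ((hq.integrable_sum ν).const_mul _) (hb.div_const _), integral_const_mul,
        hone, mul_one, integral_div, bitBhattacharyya]

lemma log_two_sub_le_bitEntropy (hq : IsSubprobWeight q) (hone : ∫ y, ∑ x, q x y ∂ν = 1)
    (A : Finset (Fin m)) (i : Fin m) :
    Real.log 2 - (1 - bitBhattacharyya ν q A i) ≤ bitEntropy ν q A i := by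
  have hb := integrable_fiberBhattacharyya ν hq A i
  have hs := hq.integrable_sum ν
  have hsb : Integrable (fun y => ∑ x, q x y -
    fiberBhattacharyya (fun x => q x y) (restrictInput A) (fun x => x i)) ν := hs.sub hb
  rw [bitEntropy_eq_integral ν hq]
  calc _ = ∫ y, (Real.log 2 * ∑ x, q x y - (∑ x, q x y -
          fiberBhattacharyya (fun x => q x y) (restrictInput A) (fun x => x i))) ∂ν := by
        rw [integral_sub (hs.const_mul _) hsb, integral_const_mul, integral_sub hs hb,
          hone, mul_one, bitBhattacharyya]
    _ ≤ _ := integral_mono ((hs.const_mul _).sub hsb)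
        ((hq.integrable_fiberEntropy ν _).sub (hq.integrable_fiberEntropy ν _)) fun y =>
          log_two_mul_sub_le_fiberEntropy_prod_bit (fun x => hq.nonneg x y) _ _

/-- The bit u₁[i] is the sum of x₁[i] and x₂[i], which are independent given the outputs. The
pointwise gain is a function of the first output times a function of the second, so its integral
factors. -/
lemma add_bitEntropy_le_outputEntropy (hq : IsSubprobWeight q)
    (hone : ∫ y, ∑ x, q x y ∂ν = 1) (A : Finset (Fin m)) (i : Fin m) :
    2 * outputEntropy ν q (restrictInput A) + bitEntropy ν q A i +
        4⁻¹ * (bitBhattacharyya ν q A i * (1 - bitBhattacharyya ν q A i)) ≤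
      outputEntropy (ν.prod ν) (pairDensity q)
        (fun p => (restrictInput (insert i A) p.1, restrictInput A p.2)) := by
  have hp := hq.pairDensity
  have hb := integrable_fiberBhattacharyya ν hq A i
  have hs := hq.integrable_sum ν
  set d : Y → ℝ := fun y => fiberEntropy (fun x => q x y) (fun x => (restrictInput A x, x i)) -
      fiberEntropy (fun x => q x y) (restrictInput A) with hd
  set b : Y → ℝ := fun y => fiberBhattacharyya (fun x => q x y) (restrictInput A) (fun x => x i)
  have hdi : Integrable d ν :=
    (hq.integrable_fiberEntropy ν _).sub (hq.integrable_fiberEntropy ν _)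
  -- In characteristic 2, (u₁[A ∪ {i}], u₂[A]) and (x₁[A], x₂[A], x₁[i] + x₂[i]) determine each
  -- other.
  have e1 : outputEntropy (ν.prod ν) (pairDensity q)
        (fun p => (restrictInput (insert i A) p.1, restrictInput A p.2)) =
      outputEntropy (ν.prod ν) (pairDensity q)
        (fun p => ((restrictInput A (p.1 + p.2), restrictInput A p.2), (p.1 + p.2) i + p.2 i)) :=
    outputEntropy_congr _ _ fun p p' => by
      have h2 (z : Input m) (w : Input m) : (z + w) i + w i = z i := by
        have := congrFun (input_add_self w) i
        simp only [Pi.add_apply, Pi.zero_apply] at this ⊢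
        rw [add_assoc, this, add_zero]
      simp only [Prod.mk.injEq, restrictInput_insert_eq_iff, restrictInput_add, h2]
      constructor
      · rintro ⟨⟨h1, h2⟩, h3⟩
        exact ⟨⟨by rw [h1, h3], h3⟩, h2⟩
      · rintro ⟨⟨h1, h2⟩, h3⟩
        exact ⟨⟨(add_left_input_iff h2).1 h1, h3⟩, h2⟩
  have e2 := outputEntropy_pairDensity hq hone (restrictInput A) (restrictInput A)
  rw [e1, two_mul, ← e2, add_assoc, ← le_sub_iff_add_le']
  have hi1 := hp.integrable_fiberEntropy (ν.prod ν)
    (fun p => ((restrictInput A (p.1 + p.2), restrictInput A p.2), (p.1 + p.2) i + p.2 i))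
  have hi2 := hp.integrable_fiberEntropy (ν.prod ν)
    (fun p => (restrictInput A (p.1 + p.2), restrictInput A p.2))
  simp only [outputEntropy]
  rw [← integral_sub hi1 hi2]
  have hj1 : Integrable (fun y : Y × Y => d y.1 * ∑ x, q x y.2) (ν.prod ν) := hdi.mul_prod hs
  have hj2 : Integrable (fun y : Y × Y => (∑ x, q x y.1 - b y.1) * b y.2) (ν.prod ν) :=
    (hs.sub hb).mul_prod hb
  calc _ = ∫ y : Y × Y, (d y.1 * ∑ x, q x y.2 + 4⁻¹ * ((∑ x, q x y.1 - b y.1) * b y.2))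
          ∂(ν.prod ν) := by
        rw [integral_add hj1 (hj2.const_mul _), integral_const_mul,
          integral_prod_mul d fun y => ∑ x, q x y,
          integral_prod_mul (fun y => ∑ x, q x y - b y) b, integral_sub hs hb, hone,
          bitEntropy_eq_integral ν hq, bitBhattacharyya]
        ring
    _ ≤ _ := by
        refine integral_mono (hj1.add (hj2.const_mul _)) (hi1.sub hi2) fun y => ?_
        have := add_le_fiberEntropy_prod_add_bit (fun x => hq.nonneg x y.1)
          (fun x => hq.nonneg x y.2) (restrictInput A) (restrictInput A) (fun x => x i)
          (fun x => x i)
        rw [← fiberEntropy_pairDensity q y fun p => ((restrictInput A p.1, restrictInput A p.2),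
          p.1 i + p.2 i), ← fiberEntropy_pairDensity q y fun p =>
            (restrictInput A p.1, restrictInput A p.2)] at this
        refine le_trans (le_of_eq ?_) this
        simp only [hd, b]
        ring

/-- The step `+` strictly decreases the conditional entropy of a single input, unless it is
extremal. -/
lemma bitEntropy_plusDensity_le (hq : IsSubprobWeight q) (hone : ∫ y, ∑ x, q x y ∂ν = 1)
    (A : Finset (Fin m)) (i : Fin m) :
    bitEntropy ((ν.prod ν).prod Measure.count) (plusDensity q) A i ≤
      bitEntropy ν q A i -
        bitEntropy ν q A i ^ 2 * (Real.log 2 - bitEntropy ν q A i) / 16 := by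
  have hp := hq.pairDensity
  have h0 := bitEntropy_nonneg ν hq A i
  have h1 := bitEntropy_le_log_two ν hq hone A i
  have h2 := log_two_sub_le_bitEntropy ν hq hone A i
  have h3 := bitBhattacharyya_nonneg ν hq A i
  have h4 := add_bitEntropy_le_outputEntropy ν hq hone A i
  set e := bitEntropy ν q A i with he
  set z := bitBhattacharyya ν q A i
  have h5 : e ^ 2 / 4 ≤ z := by
    rcases h0.eq_or_lt with h | h
    · rw [← h]; simpa using h3
    -- Taking `ε` = e/2 leaves e/2 ≤ z/(e/2), that is z ≥ e²/4.
    · have := bitEntropy_le_add_div ν hq hone A i (half_pos h)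
      have h6 : e / 2 ≤ z / (e / 2) := by linarith
      rw [le_div_iff₀ (half_pos h)] at h6
      linarith
  have h6 : e ^ 2 * (Real.log 2 - e) / 16 ≤ 4⁻¹ * (z * (1 - z)) := by
    have := mul_le_mul h5 (by linarith : Real.log 2 - e ≤ 1 - z) (by linarith) h3
    linarith
  -- Conditioning u₂[i] on u₁[A ∪ {i}] instead of all of u₁ can only raise its entropy. The weaker
  -- conditioning is computable: its entropy is 2 H(A ∪ {i}) minus the quantity bounded below in
  -- `h4`.
  have h := outputEntropy_submodular (ν.prod ν) hp Prod.fst (fun p => p.2 i)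
    (fun p => (restrictInput (insert i A) p.1, restrictInput A p.2))
  have e1 : outputEntropy (ν.prod ν) (pairDensity q)
      (fun p => (p.1, p.2 i, restrictInput (insert i A) p.1, restrictInput A p.2)) =
      outputEntropy (ν.prod ν) (pairDensity q) (fun p => (p.1, restrictInput (insert i A) p.2)) :=
    outputEntropy_congr _ _ fun x x' => by
      simp only [Prod.mk.injEq]
      rw [restrictInput_insert_eq_iff i A x.2]
      exact ⟨fun h => ⟨h.1, h.2.2.2, h.2.1⟩, fun h => ⟨h.1, h.2.2, by rw [h.1], h.2.1⟩⟩
  have e2 : outputEntropy (ν.prod ν) (pairDensity q)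
      (fun p => (p.1, restrictInput (insert i A) p.1, restrictInput A p.2)) =
      outputEntropy (ν.prod ν) (pairDensity q) (fun p => (p.1, restrictInput A p.2)) :=
    outputEntropy_congr _ _ fun x x' => by
      simp only [Prod.mk.injEq]
      exact ⟨fun h => ⟨h.1, h.2.2⟩, fun h => ⟨h.1, by rw [h.1], h.2⟩⟩
  have e3 : outputEntropy (ν.prod ν) (pairDensity q)
      (fun p => (p.2 i, restrictInput (insert i A) p.1, restrictInput A p.2)) =
      outputEntropy ν q (restrictInput (insert i A)) +
        outputEntropy ν q (restrictInput (insert i A)) := by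
    rw [← outputEntropy_pairDensity hq hone]
    exact outputEntropy_congr _ _ fun x x' => by
      have key : (x.2 i, restrictInput (insert i A) x.1, restrictInput A x.2) =
          (x'.2 i, restrictInput (insert i A) x'.1, restrictInput A x'.2) ↔
          restrictInput (insert i A) x.1 = restrictInput (insert i A) x'.1 ∧
          restrictInput (insert i A) x.2 = restrictInput (insert i A) x'.2 := by
        rw [restrictInput_insert_eq_iff i A x.2]
        simp only [Prod.mk.injEq]
        tauto
      rw [key]
      simp only [Prod.mk.injEq, restrictInput_add]
      exact ⟨fun h => ⟨by rw [h.1, h.2], h.2⟩, fun h => ⟨(add_left_input_iff h.2).1 h.1, h.2⟩⟩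
  rw [e1, e2, e3] at h
  simp only [bitEntropy, outputEntropy_plusDensity hq] at he ⊢
  linarith

end OneStep

/-! ### Inequalities for the information of a channel and its transforms -/

lemma HasChannelDensity.log_two_mul_eq_bitEntropy {m : ℕ} {Y : Type*} [MeasurableSpace Y]
    {W : Input m → Measure Y} [∀ x, IsProbabilityMeasure (W x)] {ν : Measure Y}
    [IsFiniteMeasure ν] {q : Input m → Y → ℝ} (h : HasChannelDensity W ν q)
    {J : Finset (Fin m)} {i : Fin m} (hi : i ∈ J) :
    Real.log 2 * (1 - (channelInfo W J - channelInfo W (J.erase i))) = bitEntropy ν q Jᶜ i := by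
  have h1 := h.channelInfo_mul_log_two J
  have h2 := h.channelInfo_mul_log_two (J.erase i)
  rw [Finset.compl_erase, Finset.card_erase_of_mem hi,
    Nat.cast_sub (Finset.card_pos.2 ⟨i, hi⟩), Nat.cast_one] at h2
  simp only [bitEntropy]
  linarith

namespace BMAC

variable {m : ℕ} (P : BMAC.{u} m)

lemma exists_density : ∃ (ν : Measure P.Out) (q : Input m → P.Out → ℝ),
    IsFiniteMeasure ν ∧ HasChannelDensity P.law ν q :=
  exists_hasChannelDensity P.law

lemma info_nonneg (J : Finset (Fin m)) : 0 ≤ P.info J :=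
  div_nonneg ENNReal.toReal_nonneg (Real.log_pos one_lt_two).le

lemma info_le_card (J : Finset (Fin m)) : P.info J ≤ J.card := by
  obtain ⟨ν, q, hν, h⟩ := P.exists_density
  have h1 := h.channelInfo_mul_log_two J
  have h2 : outputEntropy ν q (restrictInput Jᶜ) ≤ outputEntropy ν q (restrictInput Finset.univ) :=
    outputEntropy_mono ν h.toIsSubprobWeight fun x x' hx => by
      rw [restrictInput_univ_eq_iff] at hx; rw [hx]
  exact le_of_mul_le_mul_right (h1.trans_le (by linarith)) (Real.log_pos one_lt_two)

lemma info_empty : P.info ∅ = 0 :=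
  le_antisymm (by simpa using P.info_le_card ∅) (P.info_nonneg ∅)

/-- Up to a constant and the modular term |J|, the information is a positive multiple of H(Jᶜ).
Complementation swaps unions and intersections, so submodularity of H is inherited. -/
lemma info_submodular (J K : Finset (Fin m)) :
    P.info (J ∪ K) + P.info (J ∩ K) ≤ P.info J + P.info K := by
  obtain ⟨ν, q, hν, h⟩ := P.exists_density
  have h1 := h.channelInfo_mul_log_two J
  have h2 := h.channelInfo_mul_log_two K
  have h3 := h.channelInfo_mul_log_two (J ∪ K)
  have h4 := h.channelInfo_mul_log_two (J ∩ K)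
  have h5 := outputEntropy_restrictInput_submodular ν h.toIsSubprobWeight Jᶜ Kᶜ
  rw [Finset.compl_union] at h3
  rw [Finset.compl_inter] at h4
  have h6 : ((J ∪ K).card : ℝ) + (J ∩ K).card = J.card + K.card := by
    exact_mod_cast Finset.card_union_add_card_inter J K
  have h7 := congrArg (· * Real.log 2) h6
  simp only [add_mul] at h7
  refine le_of_mul_le_mul_right ?_ (Real.log_pos one_lt_two)
  simp only [info, add_mul]
  linarith

/-- The terms |J| cancel, so this is the growth of total conditional entropy with its sign reversed.
It is the supermartingale inequality of the process. -/
lemma minus_info_add_plus_info_le (J : Finset (Fin m)) :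
    P.minus.info J + P.plus.info J ≤ 2 * P.info J := by
  obtain ⟨ν, q, hν, h⟩ := P.exists_density
  have h1 := h.channelInfo_mul_log_two J
  have hm : ∀ x, IsProbabilityMeasure (minusLaw P.law x) := P.minus.instProb
  have hp : ∀ x, IsProbabilityMeasure (plusLaw P.law x) := P.plus.instProb
  have h2 := h.minus.channelInfo_mul_log_two J
  have h3 := h.plus.channelInfo_mul_log_two J
  have h4 := two_mul_sub_outputEntropy_le ν h.toIsSubprobWeight h.integral_sum_eq_one Jᶜ
  change channelInfo (minusLaw P.law) J + channelInfo (plusLaw P.law) J ≤ 2 * channelInfo P.law J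
  refine le_of_mul_le_mul_right ?_ (Real.log_pos one_lt_two)
  rw [add_mul, mul_assoc, h1, h2, h3]
  linarith

/-- The conditional entropy, in nats, of the input of user `i` given the output and the inputs of
the users outside `J`. -/
noncomputable def gap (J : Finset (Fin m)) (i : Fin m) : ℝ :=
  Real.log 2 * (1 - (P.info J - P.info (J.erase i)))

variable {P} {J : Finset (Fin m)} {i : Fin m}

lemma gap_nonneg (hi : i ∈ J) : 0 ≤ P.gap J i := by
  obtain ⟨ν, q, hν, h⟩ := P.exists_density
  exact (bitEntropy_nonneg ν h.toIsSubprobWeight Jᶜ i).trans_eq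
    (h.log_two_mul_eq_bitEntropy hi).symm

lemma gap_le_log_two (hi : i ∈ J) : P.gap J i ≤ Real.log 2 := by
  obtain ⟨ν, q, hν, h⟩ := P.exists_density
  exact (h.log_two_mul_eq_bitEntropy hi).trans_le
    (bitEntropy_le_log_two ν h.toIsSubprobWeight h.integral_sum_eq_one Jᶜ i)

lemma plus_gap_le (hi : i ∈ J) :
    P.plus.gap J i ≤ P.gap J i - P.gap J i ^ 2 * (Real.log 2 - P.gap J i) / 16 := by
  obtain ⟨ν, q, hν, h⟩ := P.exists_density
  have hp : ∀ x, IsProbabilityMeasure (plusLaw P.law x) := P.plus.instProb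
  have h1 : P.plus.gap J i =
      bitEntropy ((ν.prod ν).prod Measure.count) (plusDensity q) Jᶜ i :=
    h.plus.log_two_mul_eq_bitEntropy hi
  have h2 : P.gap J i = bitEntropy ν q Jᶜ i := h.log_two_mul_eq_bitEntropy hi
  rw [h1, h2]
  exact bitEntropy_plusDensity_le ν h.toIsSubprobWeight h.integral_sum_eq_one Jᶜ i

lemma polarize_congr (P : BMAC.{u} m) {n : ℕ} {s s' : ℕ → Bool} (h : ∀ k < n, s k = s' k) :
    P.polarize s n = P.polarize s' n := by
  induction n with
  | zero => rfl
  | succ n ih =>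
    rw [polarize, polarize, ih fun k hk => h k (hk.trans n.lt_succ_self), h n n.lt_succ_self]

end BMAC

/-! ### Supermartingales driven by random signs -/

section DyadicProcess

variable {Ω : Type v} [MeasurableSpace Ω] {μ : Measure Ω} {B : ℕ → Ω → Bool}

lemma IsIIDUniformSigns.ae_frequently (hB : IsIIDUniformSigns μ B) [IsProbabilityMeasure μ]
    (b : Bool) : ∀ᵐ ω ∂μ, ∃ᶠ n in atTop, B n ω = b := by
  have hmeas (n : ℕ) : MeasurableSet {ω | B n ω = b} :=
    hB.measurable n (measurableSet_singleton b)
  have hind : iIndepSet (fun n => {ω | B n ω = b}) μ := by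
    rw [iIndepSet_iff_meas_biInter hmeas]
    intro S
    exact hB.indep.measure_inter_preimage_eq_mul S (sets := fun _ => {b})
      fun _ _ => measurableSet_singleton b
  -- Second Borel–Cantelli lemma: the events are independent and their probabilities 1/2 have
  -- infinite sum.
  have h := measure_limsup_eq_one hmeas hind (by simp [hB.uniform])
  have h2 : MeasurableSet (limsup (fun n => {ω | B n ω = b}) atTop) :=
    MeasurableSet.measurableSet_limsup hmeas
  filter_upwards [(prob_compl_eq_zero_iff h2).2 h |> measure_eq_zero_iff_ae_notMem.1] with ω hω
  have h3 := mem_limsup_iff_frequently_mem.1 (Set.notMem_compl_iff.1 hω)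
  exact h3

/-- The first `n` signs. -/
def pastSigns (B : ℕ → Ω → Bool) (n : ℕ) (ω : Ω) : Finset.range n → Bool := fun k => B k ω

lemma IsIIDUniformSigns.measurable_pastSigns (hB : IsIIDUniformSigns μ B) (n : ℕ) :
    Measurable (pastSigns B n) :=
  measurable_pi_lambda _ fun k => hB.measurable k

/-- The filtration generated by the signs. -/
def IsIIDUniformSigns.filtration (hB : IsIIDUniformSigns μ B) :
    Filtration ℕ (inferInstance : MeasurableSpace Ω) where
  seq n := MeasurableSpace.comap (pastSigns B n) inferInstance
  mono' := by
    intro n n' h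
    have h1 : pastSigns B n =
        (fun (t : Finset.range n' → Bool) (k : Finset.range n) => t ⟨k, Finset.range_mono h k.2⟩) ∘ pastSigns B n' := rfl
    simp only
    rw [h1, ← MeasurableSpace.comap_comp]
    exact MeasurableSpace.comap_mono
      (measurable_pi_lambda _ fun k => measurable_pi_apply _).comap_le
  le' n := (hB.measurable_pastSigns n).comap_le

/-- Such a function factors through a finite discrete space, so no regularity of `g` is needed. The
value `false` filled in for later signs is never seen. -/
lemma IsIIDUniformSigns.measurable_of_past (hB : IsIIDUniformSigns μ B) {n : ℕ}
    {g : (ℕ → Bool) → ℝ} (hg : ∀ s s', (∀ k < n, s k = s' k) → g s = g s') :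
    Measurable[hB.filtration n] fun ω => g fun k => B k ω := by
  let G : (Finset.range n → Bool) → ℝ := fun t =>
    g fun k => if h : k ∈ Finset.range n then t ⟨k, h⟩ else false
  have h1 : (fun ω => g fun k => B k ω) = G ∘ pastSigns B n := by
    funext ω
    refine hg _ _ fun k hk => ?_
    simp [pastSigns, hk]
  rw [h1]
  exact (measurable_of_finite G).comp (comap_measurable _)

lemma IsIIDUniformSigns.condExp_indicator (hB : IsIIDUniformSigns μ B) [IsProbabilityMeasure μ]
    (n : ℕ) (b : Bool) :
    μ[fun ω => if B n ω = b then (1 : ℝ) else 0 | hB.filtration n] =ᵐ[μ] fun _ => 2⁻¹ := by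
  have hind : IndepFun (B n) (pastSigns B n) μ := by
    have h := hB.indep.indepFun_finset {n} (Finset.range n) (by simp) hB.measurable
    exact h.comp (φ := fun t : ({n} : Finset ℕ) → Bool => t ⟨n, Finset.mem_singleton_self n⟩)
      (ψ := id) (measurable_pi_apply _) measurable_id
  have hf : StronglyMeasurable[MeasurableSpace.comap (B n) inferInstance]
      fun ω => if B n ω = b then (1 : ℝ) else 0 :=
    ((measurable_of_finite fun c : Bool => if c = b then (1 : ℝ) else 0).comp
      (comap_measurable (B n))).stronglyMeasurable
  refine (condExp_indep_eq (hB.measurable n).comap_le (hB.filtration.le n) hf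
    (IndepFun_iff_Indep _ _ _ |>.1 hind)).trans (Eventually.of_forall fun _ => ?_)
  have h1 : (fun ω => if B n ω = b then (1 : ℝ) else 0) = {ω | B n ω = b}.indicator 1 := by
    funext ω
    simp [Set.indicator_apply]
  simp only
  have h2 : MeasurableSet {ω | B n ω = b} := hB.measurable n (measurableSet_singleton b)
  rw [h1, integral_indicator_one h2, measureReal_def, hB.uniform]
  simp

/-- A bounded process that depends on the past signs and decreases on average converges almost
surely. -/
lemma IsIIDUniformSigns.ae_exists_tendsto (hB : IsIIDUniformSigns μ B) [IsProbabilityMeasure μ]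
    {g : ℕ → (ℕ → Bool) → ℝ} {C : ℝ} (hg : ∀ n s s', (∀ k < n, s k = s' k) → g n s = g n s')
    (hC : ∀ n s, |g n s| ≤ C)
    (hstep : ∀ n s, g (n + 1) (Function.update s n false) +
      g (n + 1) (Function.update s n true) ≤ 2 * g n s) :
    ∀ᵐ ω ∂μ, ∃ c, Tendsto (fun n => g n fun k => B k ω) atTop (𝓝 c) := by
  have hbd (h : Ω → ℝ) (hm : Measurable h) (hh : ∀ ω, |h ω| ≤ C) : Integrable h μ :=
    Integrable.of_bound hm.aestronglyMeasurable C (Eventually.of_forall hh)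
  have hmeas (n : ℕ) := hB.measurable_of_past (hg n)
  have hmeas' (n : ℕ) : Measurable fun ω => g n fun k => B k ω :=
    (hmeas n).mono (hB.filtration.le n) le_rfl
  have hsub : Submartingale (fun n ω => -g n fun k => B k ω) hB.filtration μ := by
    refine submartingale_nat (fun n => (hmeas n).neg.stronglyMeasurable)
      (fun n => (hbd _ (hmeas' n) fun ω => hC n _).neg) fun n => ?_
    let φ (b : Bool) (ω : Ω) : ℝ := if B n ω = b then 1 else 0
    -- Splitting by the sign at time n: h b depends only on earlier signs, while φ b has conditional
    -- mean 1/2. The conditional mean of the next value is thus the average over both continuations.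
    let h (b : Bool) (ω : Ω) : ℝ := -g (n + 1) (Function.update (fun k => B k ω) n b)
    have hφm (b : Bool) : Measurable (φ b) :=
      (measurable_of_finite fun c : Bool => if c = b then (1 : ℝ) else 0).comp (hB.measurable n)
    have hφi (b : Bool) : Integrable (φ b) μ :=
      Integrable.of_bound (hφm b).aestronglyMeasurable 1 (Eventually.of_forall fun ω => by
        simp only [φ]; split_ifs <;> simp)
    have hhm (b : Bool) : Measurable[hB.filtration n] (h b) := by
      refine Measurable.neg (hB.measurable_of_past
        (g := fun s => g (n + 1) (Function.update s n b)) fun s s' hs => hg _ _ _ fun k hk => ?_)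
      rcases (Nat.lt_succ_iff.1 hk).eq_or_lt with rfl | hk'
      · simp
      · simp [Function.update_of_ne hk'.ne, hs k hk']
    have hhφi (b : Bool) : Integrable (h b * φ b) μ := by
      refine Integrable.of_bound (C := C) (((hhm b).mono (hB.filtration.le n) le_rfl).mul
        (hφm b)).aestronglyMeasurable (Eventually.of_forall fun ω => ?_)
      have := hC (n + 1) (Function.update (fun k => B k ω) n b)
      simp only [Pi.mul_apply, φ, h, Real.norm_eq_abs]
      split_ifs
      · simpa using this
      · simpa using (abs_nonneg _).trans this
    have hsum : (fun ω => -g (n + 1) fun k => B k ω) = h false * φ false + h true * φ true := by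
      funext ω
      have h1 : Function.update (fun k => B k ω) n (B n ω) = fun k => B k ω :=
        Function.update_eq_self n _
      cases hb : B n ω <;> rw [hb] at h1 <;> simp [h, φ, hb, h1]
    rw [hsum]
    have hc (b : Bool) : μ[h b * φ b | hB.filtration n] =ᵐ[μ] h b * μ[φ b | hB.filtration n] :=
      condExp_mul_of_stronglyMeasurable_left (hhm b).stronglyMeasurable (hhφi b) (hφi b)
    filter_upwards [condExp_add (hhφi false) (hhφi true) (hB.filtration n), hc false, hc true,
      hB.condExp_indicator n false, hB.condExp_indicator n true] with ω h1 h2 h3 h4 h5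
    have h6 := hstep n fun k => B k ω
    have h4' : (μ[φ false | hB.filtration n]) ω = 2⁻¹ := h4
    have h5' : (μ[φ true | hB.filtration n]) ω = 2⁻¹ := h5
    rw [h1, Pi.add_apply, h2, h3, Pi.mul_apply, Pi.mul_apply, h4', h5']
    simp only [h]
    linarith
  have hlim := hsub.exists_ae_tendsto_of_bdd (R := C.toNNReal) fun n => by
    refine (eLpNorm_le_of_ae_bound (C := C) (Eventually.of_forall fun ω => ?_)).trans ?_
    · simpa using hC n fun k => B k ω
    · simp [ENNReal.ofReal]
  filter_upwards [hlim] with ω ⟨c, hc⟩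
  exact ⟨-c, by simpa using hc.neg⟩

end DyadicProcess

/-! ### The limit is a matroid rank function -/

section LimitIsMatroid

variable {m : ℕ}

/-- A submodular function whose increments are `0` or `1` is a matroid rank function. -/
lemma isMatroidRank_of_increments {f : Finset (Fin m) → ℝ} (h0 : f ∅ = 0)
    (hstep : ∀ J, ∀ i ∈ J, f J - f (J.erase i) ∈ ({0, 1} : Set ℝ))
    (hsub : ∀ J K, f (J ∪ K) + f (J ∩ K) ≤ f J + f K) : IsMatroidRank f := by
  have hins (J : Finset (Fin m)) (i : Fin m) (hi : i ∉ J) :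
      f (insert i J) = f J ∨ f (insert i J) = f J + 1 := by
    have h := hstep (insert i J) i (Finset.mem_insert_self i J)
    rw [Finset.erase_insert hi] at h
    rcases h with h | h
    · left; linarith
    · right; rw [Set.mem_singleton_iff] at h; linarith
  have hle (J : Finset (Fin m)) (i : Fin m) : f J ≤ f (insert i J) := by
    by_cases hi : i ∈ J
    · rw [Finset.insert_eq_of_mem hi]
    · rcases hins J i hi with h | h <;> linarith
  refine ⟨⟨h0, fun J K hJK => ?_, hsub⟩, fun J => ?_, fun J => ?_⟩
  · have key (S : Finset (Fin m)) : f J ≤ f (S ∪ J) := by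
      induction S using Finset.induction_on with
      | empty => simp
      | insert i S _ ih => rw [Finset.insert_union]; exact ih.trans (hle _ i)
    simpa [Finset.union_eq_left.2 hJK] using key K
  · induction J using Finset.induction_on with
    | empty => exact ⟨0, by simpa using h0⟩
    | insert i J hi ih =>
      obtain ⟨k, hk⟩ := ih
      rcases hins J i hi with h | h
      · exact ⟨k, by rw [h, hk]⟩
      · exact ⟨k + 1, by rw [h, hk]; push_cast; ring⟩
  · induction J using Finset.induction_on with
    | empty => simp [h0]
    | insert i J hi ih =>
      rw [Finset.card_insert_of_notMem hi]
      push_cast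
      rcases hins J i hi with h | h <;> linarith

/-- The support lies in every closed set of full measure, so closedness is what transfers the almost
sure statement to it. Integrality is a closed condition because ℤ is closed in ℝ. -/
lemma isClosed_MAT (m : ℕ) : IsClosed (MAT m) := by
  have h : MAT m = {f | f ∅ = 0} ∩ (⋂ J, ⋂ K, {f | J ⊆ K → f J ≤ f K}) ∩
      (⋂ J, ⋂ K, {f | f (J ∪ K) + f (J ∩ K) ≤ f J + f K}) ∩
      (⋂ J, {f | f J ∈ Set.range ((↑) : ℤ → ℝ)}) ∩ (⋂ J, {f | f J ≤ J.card}) := by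
    ext f
    simp only [MAT, Set.mem_ofPred_eq, Set.mem_inter_iff, Set.mem_iInter, Set.mem_range]
    constructor
    · rintro ⟨⟨h1, h2, h3⟩, h4, h5⟩
      exact ⟨⟨⟨⟨h1, h2⟩, h3⟩, fun J => (h4 J).imp fun _ h => h.symm⟩, h5⟩
    · rintro ⟨⟨⟨⟨h1, h2⟩, h3⟩, h4⟩, h5⟩
      exact ⟨⟨h1, h2, h3⟩, fun J => (h4 J).imp fun _ h => h.symm, h5⟩
  rw [h]
  refine ((((isClosed_eq (continuous_apply _) continuous_const).inter ?_).inter ?_).inter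
    ?_).inter ?_
  · refine isClosed_iInter fun J => isClosed_iInter fun K => ?_
    by_cases hJK : J ⊆ K
    · simpa [hJK] using isClosed_le (continuous_apply J) (continuous_apply K)
    · simp [hJK]
  · exact isClosed_iInter fun J => isClosed_iInter fun K => isClosed_le (by fun_prop) (by fun_prop)
  · exact isClosed_iInter fun J =>
      Int.isClosedEmbedding_coe_real.isClosed_range.preimage (continuous_apply J)
  · exact isClosed_iInter fun J => isClosed_le (continuous_apply J) continuous_const

variable {P : BMAC.{u} m} {s : ℕ → Bool} {L : Finset (Fin m) → ℝ}

/-- Along a sequence with infinitely many signs `+`, the increments of the limit are `0` or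
`1`. -/
lemma sub_erase_mem_of_tendsto
    (hL : ∀ J, Tendsto (fun n => (P.polarize s n).info J) atTop (𝓝 (L J)))
    (hs : ∃ᶠ n in atTop, s n = true) {J : Finset (Fin m)} {i : Fin m} (hi : i ∈ J) :
    L J - L (J.erase i) ∈ ({0, 1} : Set ℝ) := by
  have hlog : Real.log 2 ≠ 0 := (Real.log_pos one_lt_two).ne'
  set e : ℝ := Real.log 2 * (1 - (L J - L (J.erase i))) with he
  have hgap : Tendsto (fun n => (P.polarize s n).gap J i) atTop (𝓝 e) :=
    (((hL J).sub (hL (J.erase i))).const_sub 1).const_mul _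
  have h0 : 0 ≤ e := ge_of_tendsto' hgap fun n => BMAC.gap_nonneg hi
  have h1 : e ≤ Real.log 2 := le_of_tendsto' hgap fun n => BMAC.gap_le_log_two hi
  have hstep : ∃ᶠ n in atTop, (P.polarize s (n + 1)).gap J i ≤ (P.polarize s n).gap J i -
      (P.polarize s n).gap J i ^ 2 * (Real.log 2 - (P.polarize s n).gap J i) / 16 :=
    hs.mono fun n hn => by
      rw [BMAC.polarize, if_pos hn]
      exact BMAC.plus_gap_le hi
  -- Both sides converge along all n, so an inequality valid only at the infinitely many times of
  -- sign + survives in the limit.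
  have hle := le_of_tendsto_of_tendsto_of_frequently (hgap.comp (tendsto_add_atTop_nat 1))
    (hgap.sub (((hgap.pow 2).mul (hgap.const_sub (Real.log 2))).div_const 16)) hstep
  have hz : e ^ 2 * (Real.log 2 - e) = 0 :=
    le_antisymm (by linarith) (mul_nonneg (sq_nonneg e) (sub_nonneg.2 h1))
  rcases mul_eq_zero.1 hz with h | h
  · right
    have : 1 - (L J - L (J.erase i)) = 0 :=
      (mul_eq_zero.1 (pow_eq_zero_iff two_ne_zero |>.1 h)).resolve_left hlog
    rw [Set.mem_singleton_iff]
    linarith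
  · left
    have : Real.log 2 * (L J - L (J.erase i)) = 0 := by rw [he] at h; linarith
    exact (mul_eq_zero.1 this).resolve_left hlog

lemma isMatroidRank_of_tendsto
    (hL : ∀ J, Tendsto (fun n => (P.polarize s n).info J) atTop (𝓝 (L J)))
    (hs : ∃ᶠ n in atTop, s n = true) : IsMatroidRank L := by
  refine isMatroidRank_of_increments ?_ (fun J i hi => sub_erase_mem_of_tendsto hL hs hi)
    fun J K => ?_
  · exact tendsto_nhds_unique (hL ∅) (by simp [BMAC.info_empty])
  · exact le_of_tendsto_of_tendsto' ((hL _).add (hL _)) ((hL J).add (hL K)) fun n =>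
      (P.polarize s n).info_submodular J K

/-- The value of `infoLimit` is meaningful only where a limit exists. Existence comes from the
supermartingale inequality and the bounds 0 ≤ I[J] ≤ |J|, simultaneously for the finitely many J. -/
lemma ae_tendsto_infoLimit {Ω : Type v} [MeasurableSpace Ω] {μ : Measure Ω}
    [IsProbabilityMeasure μ] {B : ℕ → Ω → Bool} (hB : IsIIDUniformSigns μ B) (P : BMAC.{u} m) :
    ∀ᵐ ω ∂μ, ∀ J : Finset (Fin m),
      Tendsto (fun n => (P.polarize (fun k => B k ω) n).info J) atTop
        (𝓝 (P.infoLimit (fun k => B k ω) J)) := by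
  rw [ae_all_iff]
  intro J
  have h := hB.ae_exists_tendsto (g := fun n s => (P.polarize s n).info J) (C := J.card)
    (fun n s s' hs => by simp only [P.polarize_congr hs])
    (fun n s => by
      rw [abs_of_nonneg (BMAC.info_nonneg _ _)]
      exact BMAC.info_le_card _ _)
    (fun n s => by
      have hc (b : Bool) : P.polarize (Function.update s n b) n = P.polarize s n :=
        P.polarize_congr fun k hk => Function.update_of_ne hk.ne _ _
      simpa [BMAC.polarize, hc] using (P.polarize s n).minus_info_add_plus_info_le J)
  filter_upwards [h] with ω hω
  exact tendsto_nhds_limUnder hω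

end LimitIsMatroid

theorem mainTheorem5 (m : ℕ) (P : BMAC.{u} m) {Ω : Type v} [MeasurableSpace Ω]
    (μ : Measure Ω) [IsProbabilityMeasure μ] (B : ℕ → Ω → Bool) (hB : IsIIDUniformSigns μ B) :
    (∀ᵐ ω ∂μ, ∀ J : Finset (Fin m),
      Tendsto (fun n => (P.polarize (fun k => B k ω) n).info J) atTop
        (𝓝 (P.infoLimit (fun k => B k ω) J))) ∧
    (∀ᵐ ω ∂μ, ∀ J : Finset (Fin m), ∀ i ∈ J,
      P.infoLimit (fun k => B k ω) J - P.infoLimit (fun k => B k ω) (J.erase i)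
        ∈ ({0, 1} : Set ℝ)) ∧
    (∀ᵐ ω ∂μ, IsMatroidRank (P.infoLimit fun k => B k ω)) ∧
    AEMeasurable (fun ω => P.infoLimit fun k => B k ω) μ ∧
    limitSupport μ B P ⊆ MAT m := by
  have hlim := ae_tendsto_infoLimit hB P
  have hfreq := hB.ae_frequently true
  have hmat : ∀ᵐ ω ∂μ, IsMatroidRank (P.infoLimit fun k => B k ω) := by
    filter_upwards [hlim, hfreq] with ω h1 h2
    exact isMatroidRank_of_tendsto h1 h2
  have hmeas : AEMeasurable (fun ω => P.infoLimit fun k => B k ω) μ := by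
    refine aemeasurable_pi_lambda _ fun J => ?_
    -- Each coordinate is an almost sure limit of functions of finitely many signs.
    refine aemeasurable_of_tendsto_metrizable_ae atTop
      (f := fun n ω => (P.polarize (fun k => B k ω) n).info J) (fun n => ?_)
      (hlim.mono fun ω h => h J)
    exact ((hB.measurable_of_past (n := n) (g := fun s => (P.polarize s n).info J)
      fun s s' hs => by simp only [P.polarize_congr hs]).mono (hB.filtration.le n)
        le_rfl).aemeasurable
  refine ⟨hlim, ?_, hmat, hmeas, ?_⟩
  · filter_upwards [hlim, hfreq] with ω h1 h2 J i hi
    exact sub_erase_mem_of_tendsto h1 h2 hi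
  · exact Measure.support_subset_of_isClosed (isClosed_MAT m)
      ((mem_ae_map_iff hmeas (isClosed_MAT m).measurableSet).2 hmat)
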